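/- Setting. Let $(X,d)$ be a compact metric space with at least two points and diameter at most $1$, let $J$ be a non-empty finite or countable set, and for $j\in J$ let $\sigma_j:X\to X$ and $\varphi_j:X\to\mathbb R$ be maps such that, for some constants $\gamma>1$ and $G>0$, 1. $d(\sigma_jx,\sigma_jy)\le\gamma^{-1}d(x,y)$ for all $x,y\in X$, $j\in J$; 2. $|\varphi_j(x)-\varphi_j(y)|\le G\,d(x,y)$ for all $x,y\in X$, $j\in J$; 3. $\sup_{x\in X}\sum_{j\in J}e^{\varphi_j(x)}<\infty$. (The $\sigma_j$ are the inverse branches of a uniformly expanding map $T$ and $\varphi_j=g\circ\sigma_j$ for a potential $g$. For a full-branched Markov map $T$ of $X=[0,1]$, with $d$ a metric compatible with the topology, one takes $g=-\log|T'|$, each $\varphi_j$ being extended continuously to the endpoints. For a continuous map $T$ of a compact metric space, $T\circ\sigma_j=\mathrm{id}$ and $g:X\to\mathbb R$.) For $\mathbb K=\mathbb R$ or $\mathbb C$, let $\mathrm{Lip}(X;\mathbb K)$ be the Banach space of bounded Lipschitz functions $u:X\to\mathbb K$ with norm $\|u\|_\infty+|u|_\ell$, where $|u|_\ell=\sup_{x\ne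 y}|u(x)-u(y)|/d(x,y)$. Fix $f\in\mathrm{Lip}(X;\mathbb R)$, and for $z\in\mathbb C$ let $\mathcal L(z)$ be the bounded operator on $\mathrm{Lip}(X;\mathbb C)$ given by $$[\mathcal L(z)u](x)=\sum_{j\in J}e^{\varphi_j(x)+zf(\sigma_jx)}\,u(\sigma_jx).$$ Cones. Put $B=\dfrac{\gamma G+1}{\gamma-1}$ and $$\mathcal C_{\mathbb R}=\{u\in\mathrm{Lip}(X;\mathbb R):\ e^{Bd(x,y)}u(y)-u(x)\ge0\ \text{ for all }x,y\in X\}.$$ Let $\mathcal C_{\mathbb R}'$ be the set of continuous real linear functionals on $\mathrm{Lip}(X;\mathbb R)$ that are nonnegative on $\mathcal C_{\mathbb R}$, extended complex linearly to $\mathrm{Lip}(X;\mathbb C)$. Let $$\mathcal C=\{w\in\mathrm{Lip}(X;\mathbb C)\setminus\{0\}:\ \mathrm{Re}\big(\langle l_1,w\rangle\overline{\langle l_2,w\rangle}\big)\ge0\ \text{ for all }l_1,l_2\in\mathcal C_{\mathbb R}'\}$$ be its canonical complexification without $0$, and let the dual complement $\mathcal C'$ be the set of all continuous linear functionals on $\mathrm{Lip}(X;\mathbb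 C)$ that vanish nowhere on $\mathcal C$. Constants. Let $$D_{\mathbb R}=\frac{2(\gamma^2G+1)}{\gamma(\gamma-1)}+2\log\frac{2\gamma^2G+\gamma+1}{\gamma-1},$$ and let $\delta_0$ satisfy $$\delta_0\big(\|f\|_\infty+|f|_\ell\big)=\frac1{3\big(1+\cosh(D_{\mathbb R}/2)\big)}$$ (so $f\ne0$ and $\delta_0>0$). Statement. For every $z\in\mathbb C$ with $|z|\le\delta_0$ there are $h(z)\in\mathcal C$, $\nu(z)\in\mathcal C'$ and $\lambda(z)\in\mathbb C\setminus\{0\}$ such that $$\mathcal L(z)h(z)=\lambda(z)h(z),\qquad \nu(z)\mathcal L(z)=\lambda(z)\nu(z),\qquad \langle\nu(z),h(z)\rangle=1,\qquad\langle\nu(z),1\rangle=1;$$ $\lambda(z)$ is a simple eigenvalue of $\mathcal L(z)$ (that is, $\ker(\mathcal L(z)-\lambda(z))$ is one-dimensional and complementary to the range of $\mathcal L(z)-\lambda(z)$), and the rest of the spectrum of $\mathcal L(z)$ is contained in a disc centred at $0$ of radius strictly smaller than $|\lambda(z)|$. Moreover, $h$, $\nu$ and $\lambda$ are holomorphic functions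 of $z$ (with values in $\mathrm{Lip}(X;\mathbb C)$, its dual space and $\mathbb C$) in the open disc $|z|<\delta_0$. -/

import Mathlib

noncomputable section

namespace ExpandingMaps

/-! ### The space of bounded Lipschitz functions -/

/-- Bounded Lipschitz functions `X → 𝕜`, as a linear subspace of all functions. -/
def lipSubmodule (X 𝕜 : Type*) [MetricSpace X] [RCLike 𝕜] : Submodule 𝕜 (X → 𝕜) where
  carrier := {u | (∃ M : ℝ, ∀ x, ‖u x‖ ≤ M) ∧ ∃ K : ℝ, ∀ x y, ‖u x - u y‖ ≤ K * dist x y}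
  zero_mem' := ⟨⟨0, fun x => by simp⟩, ⟨0, fun x y => by simp⟩⟩
  add_mem' := by
    rintro u v ⟨⟨M, hM⟩, ⟨K, hK⟩⟩ ⟨⟨M', hM'⟩, ⟨K', hK'⟩⟩
    refine ⟨⟨M + M', fun x => (norm_add_le _ _).trans (add_le_add (hM x) (hM' x))⟩,
      ⟨K + K', fun x y => ?_⟩⟩
    have h : (u + v) x - (u + v) y = (u x - u y) + (v x - v y) := by
      simp only [Pi.add_apply]; ring
    rw [h, add_mul]
    exact (norm_add_le _ _).trans (add_le_add (hK x y) (hK' x y))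
  smul_mem' := by
    rintro c u ⟨⟨M, hM⟩, ⟨K, hK⟩⟩
    refine ⟨⟨‖c‖ * M, fun x => ?_⟩, ⟨‖c‖ * K, fun x y => ?_⟩⟩
    · simp only [Pi.smul_apply, norm_smul]
      exact mul_le_mul_of_nonneg_left (hM x) (norm_nonneg _)
    · have h : (c • u) x - (c • u) y = c • (u x - u y) := by
        simp only [Pi.smul_apply, smul_sub]
      rw [h, norm_smul, mul_assoc]
      exact mul_le_mul_of_nonneg_left (hK x y) (norm_nonneg _)

/-- The space `Lip(X; 𝕜)`. It is a type of its own, so that it carries the Lipschitz norm and not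
the topology of pointwise convergence. -/
def Lip (X 𝕜 : Type*) [MetricSpace X] [RCLike 𝕜] : Type _ := lipSubmodule X 𝕜

namespace Lip

section Basic

variable {X 𝕜 : Type*} [MetricSpace X] [RCLike 𝕜]

instance : AddCommGroup (Lip X 𝕜) := inferInstanceAs (AddCommGroup (lipSubmodule X 𝕜))

instance : Module 𝕜 (Lip X 𝕜) := inferInstanceAs (Module 𝕜 (lipSubmodule X 𝕜))

instance : CoeFun (Lip X 𝕜) (fun _ => X → 𝕜) := ⟨fun u => u.1⟩

/-- The supremum norm `‖u‖_∞`. -/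
def supNorm (u : Lip X 𝕜) : ℝ := ⨆ x, ‖u x‖

/-- The best Lipschitz constant `|u|_ℓ = sup_{x ≠ y} |u x - u y| / d(x, y)`
(diagonal pairs contribute `0`). -/
def lipConst (u : Lip X 𝕜) : ℝ := ⨆ p : X × X, ‖u p.1 - u p.2‖ / dist p.1 p.2

theorem ext {u v : Lip X 𝕜} (h : ∀ x, u x = v x) : u = v := Subtype.ext (funext h)

@[simp] theorem zero_apply (x : X) : (0 : Lip X 𝕜) x = 0 := rfl

@[simp] theorem add_apply (u v : Lip X 𝕜) (x : X) : (u + v) x = u x + v x := rfl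

@[simp] theorem neg_apply (u : Lip X 𝕜) (x : X) : (-u) x = -u x := rfl

@[simp] theorem smul_apply (c : 𝕜) (u : Lip X 𝕜) (x : X) : (c • u) x = c • u x := rfl

theorem norm_apply_le (u : Lip X 𝕜) (x : X) : ‖u x‖ ≤ supNorm u := by
  obtain ⟨M, hM⟩ := u.2.1
  exact le_ciSup (f := fun x => ‖u x‖) ⟨M, by rintro _ ⟨y, rfl⟩; exact hM y⟩ x

theorem supNorm_nonneg (u : Lip X 𝕜) : 0 ≤ supNorm u := Real.iSup_nonneg fun _ => norm_nonneg _

theorem lipConst_nonneg (u : Lip X 𝕜) : 0 ≤ lipConst u :=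
  Real.iSup_nonneg fun _ => div_nonneg (norm_nonneg _) dist_nonneg

theorem norm_sub_le (u : Lip X 𝕜) (x y : X) : ‖u x - u y‖ ≤ lipConst u * dist x y := by
  rcases eq_or_ne x y with rfl | hxy
  · simp
  obtain ⟨K, hK⟩ := u.2.2
  rw [← div_le_iff₀ (dist_pos.2 hxy)]
  refine le_ciSup (f := fun p : X × X => ‖u p.1 - u p.2‖ / dist p.1 p.2)
    ⟨max K 0, ?_⟩ (x, y)
  rintro _ ⟨⟨a, b⟩, rfl⟩
  exact div_le_of_le_mul₀ dist_nonneg (le_max_right _ _)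
    ((hK a b).trans (mul_le_mul_of_nonneg_right (le_max_left _ _) dist_nonneg))

theorem supNorm_le {u : Lip X 𝕜} {M : ℝ} (h0 : 0 ≤ M) (h : ∀ x, ‖u x‖ ≤ M) : supNorm u ≤ M :=
  Real.iSup_le h h0

theorem lipConst_le {u : Lip X 𝕜} {K : ℝ} (h0 : 0 ≤ K)
    (h : ∀ x y, ‖u x - u y‖ ≤ K * dist x y) : lipConst u ≤ K :=
  Real.iSup_le (fun p => div_le_of_le_mul₀ dist_nonneg h0 (h p.1 p.2)) h0

/-- The norm `‖u‖ = ‖u‖_∞ + |u|_ℓ`. -/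
instance : NormedAddCommGroup (Lip X 𝕜) :=
  AddGroupNorm.toNormedAddCommGroup
    { toFun := fun u => supNorm u + lipConst u
      map_zero' := by simp [supNorm, lipConst]
      add_le' := fun u v => by
        have h1 : supNorm (u + v) ≤ supNorm u + supNorm v :=
          supNorm_le (add_nonneg (supNorm_nonneg _) (supNorm_nonneg _)) fun x =>
            (norm_add_le _ _).trans (add_le_add (norm_apply_le u x) (norm_apply_le v x))
        have h2 : lipConst (u + v) ≤ lipConst u + lipConst v := by
          refine lipConst_le (add_nonneg (lipConst_nonneg _) (lipConst_nonneg _)) fun x y => ?_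
          have h : (u + v) x - (u + v) y = (u x - u y) + (v x - v y) := by
            simp only [add_apply]; ring
          rw [h, add_mul]
          exact (norm_add_le _ _).trans (add_le_add (norm_sub_le u x y) (norm_sub_le v x y))
        linarith
      neg' := fun u => by
        have h : ∀ x y, ‖-u x - -u y‖ = ‖u x - u y‖ := fun x y => by
          rw [← norm_neg]; congr 1; ring
        simp only [supNorm, lipConst, neg_apply, norm_neg, h]
      eq_zero_of_map_eq_zero' := fun u hu => by
        have h0 : supNorm u = 0 := by
          have h1 := supNorm_nonneg u
          have h2 := lipConst_nonneg u
          linarith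
        refine ext fun x => ?_
        have h3 := norm_apply_le u x
        rw [h0] at h3
        exact norm_le_zero_iff.1 h3 }

theorem norm_def (u : Lip X 𝕜) : ‖u‖ = supNorm u + lipConst u := rfl

instance : NormedSpace 𝕜 (Lip X 𝕜) where
  norm_smul_le c u := by
    have h1 : supNorm (c • u) ≤ ‖c‖ * supNorm u :=
      supNorm_le (mul_nonneg (norm_nonneg _) (supNorm_nonneg _)) fun x => by
        rw [smul_apply, norm_smul]
        exact mul_le_mul_of_nonneg_left (norm_apply_le u x) (norm_nonneg _)
    have h2 : lipConst (c • u) ≤ ‖c‖ * lipConst u := by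
      refine lipConst_le (mul_nonneg (norm_nonneg _) (lipConst_nonneg _)) fun x y => ?_
      rw [smul_apply, smul_apply, ← smul_sub, norm_smul, mul_assoc]
      exact mul_le_mul_of_nonneg_left (norm_sub_le u x y) (norm_nonneg _)
    rw [norm_def, norm_def, mul_add]
    exact add_le_add h1 h2

/-- The constant function `1`. -/
instance : One (Lip X 𝕜) := ⟨⟨fun _ => 1, ⟨1, fun x => by simp⟩, ⟨0, fun x y => by simp⟩⟩⟩

@[simp] theorem one_apply (x : X) : (1 : Lip X 𝕜) x = 1 := rfl

end Basic

section RealImaginary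

variable {X : Type*} [MetricSpace X]

/-- The real part of a complex Lipschitz function. -/
def re (w : Lip X ℂ) : Lip X ℝ :=
  ⟨fun x => (w x).re, ⟨supNorm w, fun x => (Complex.abs_re_le_norm _).trans (norm_apply_le w x)⟩,
    ⟨lipConst w, fun x y => by
      rw [← Complex.sub_re]
      exact (Complex.abs_re_le_norm _).trans (norm_sub_le w x y)⟩⟩

/-- The imaginary part of a complex Lipschitz function. -/
def im (w : Lip X ℂ) : Lip X ℝ :=
  ⟨fun x => (w x).im, ⟨supNorm w, fun x => (Complex.abs_im_le_norm _).trans (norm_apply_le w x)⟩,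
    ⟨lipConst w, fun x y => by
      rw [← Complex.sub_im]
      exact (Complex.abs_im_le_norm _).trans (norm_sub_le w x y)⟩⟩

end RealImaginary

end Lip

/-! ### Inverse branches, weights, and the transfer operators -/

/-- The inverse branches `σ j` of a uniformly expanding map `T` of a metric space of diameter at
most `1`, together with the weights `φ j`, where `φ j` is the potential `g` along the branch,
`φ j x = g (σ j x)`, and with the constants `γ` and `G`.

For a piecewise monotone full-branched map `T` of `[0, 1]` with a metric `d` compatible with the
topology, `σ j : [0, 1] → [a_j, b_j]` is the inverse of `T` on `(a_j, b_j)` and `φ j` is the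
(Lipschitz extension to `[0, 1]` of the) function `-log |T' (σ j x)|`. For a continuous map `T` of a
compact metric space, `σ j` satisfies `T (σ j x) = x` and `φ j x = g (σ j x)`. Only `σ` and `φ` enter
the transfer operator. -/
structure BranchSystem (X J : Type*) [MetricSpace X] where
  /-- the inverse branches -/
  σ : J → X → X
  /-- the potential along the branches -/
  φ : J → X → ℝ
  /-- the expansion constant -/
  γ : ℝ
  /-- the distortion constant -/
  G : ℝ
  dist_le_one : ∀ x y : X, dist x y ≤ 1
  one_lt_γ : 1 < γ
  G_pos : 0 < G
  contraction : ∀ j x y, dist (σ j x) (σ j y) ≤ γ⁻¹ * dist x y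
  distortion : ∀ j x y, |φ j x - φ j y| ≤ G * dist x y
  summable_weights : ∀ x, Summable fun j => Real.exp (φ j x)
  bddAbove_weights : BddAbove (Set.range fun x => ∑' j, Real.exp (φ j x))

namespace BranchSystem

section Operators

variable {X J : Type*} [MetricSpace X] (S : BranchSystem X J)

/-- The `j`-th term `e^{φ_j(x) + z f(σ_j x)} u(σ_j x)` of the perturbed transfer operator. -/
def term (f : Lip X ℝ) (z : ℂ) (u : Lip X ℂ) (x : X) (j : J) : ℂ :=
  Complex.exp ((S.φ j x : ℂ) + z * (f (S.σ j x) : ℂ)) * u (S.σ j x)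

theorem norm_weight_le (f : Lip X ℝ) (z : ℂ) (x : X) (j : J) :
    ‖Complex.exp ((S.φ j x : ℂ) + z * (f (S.σ j x) : ℂ))‖ ≤
      Real.exp (S.φ j x) * Real.exp (‖z‖ * f.supNorm) := by
  rw [Complex.norm_exp, ← Real.exp_add, Complex.add_re, Complex.ofReal_re]
  refine Real.exp_le_exp.2 (add_le_add le_rfl ?_)
  refine (Complex.re_le_norm _).trans ?_
  rw [norm_mul, Complex.norm_real]
  exact mul_le_mul_of_nonneg_left (f.norm_apply_le _) (norm_nonneg _)

theorem norm_term_le (f : Lip X ℝ) (z : ℂ) (u : Lip X ℂ) (x : X) (j : J) :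
    ‖S.term f z u x j‖ ≤ Real.exp (S.φ j x) * (Real.exp (‖z‖ * f.supNorm) * u.supNorm) := by
  rw [term, norm_mul, ← mul_assoc]
  exact mul_le_mul (S.norm_weight_le f z x j) (u.norm_apply_le _) (norm_nonneg _) (by positivity)

theorem summable_term (f : Lip X ℝ) (z : ℂ) (u : Lip X ℂ) (x : X) :
    Summable (S.term f z u x) :=
  Summable.of_norm_bounded ((S.summable_weights x).mul_right _) (S.norm_term_le f z u x)

theorem dist_σ_le (j : J) (x y : X) : dist (S.σ j x) (S.σ j y) ≤ dist x y :=
  (S.contraction j x y).trans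
    (mul_le_of_le_one_left dist_nonneg (inv_le_one_of_one_le₀ S.one_lt_γ.le))

/-- A bound for the logarithmic variation of the weights `e^{φ_j + z f ∘ σ_j}`. -/
def H (f : Lip X ℝ) (z : ℂ) : ℝ := S.G + ‖z‖ * f.lipConst

theorem H_nonneg (f : Lip X ℝ) (z : ℂ) : 0 ≤ S.H f z :=
  add_nonneg S.G_pos.le (mul_nonneg (norm_nonneg _) f.lipConst_nonneg)

theorem norm_weight_sub_le (f : Lip X ℝ) (z : ℂ) (x y : X) (j : J) :
    ‖Complex.exp ((S.φ j x : ℂ) + z * (f (S.σ j x) : ℂ)) -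
        Complex.exp ((S.φ j y : ℂ) + z * (f (S.σ j y) : ℂ))‖ ≤
      Real.exp (S.φ j x) * Real.exp (‖z‖ * f.supNorm) *
        (S.H f z * Real.exp (S.H f z) * dist x y) := by
  set a : ℂ := (S.φ j x : ℂ) + z * (f (S.σ j x) : ℂ) with ha
  set b : ℂ := (S.φ j y : ℂ) + z * (f (S.σ j y) : ℂ) with hb
  have h1 : Complex.exp a - Complex.exp b = -(Complex.exp a * (Complex.exp (b - a) - 1)) := by
    rw [mul_sub, ← Complex.exp_add]; ring_nf
  have hw : ‖b - a‖ ≤ S.H f z * dist x y := by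
    have h2 : b - a = ((S.φ j y - S.φ j x : ℝ) : ℂ) +
        z * ((f (S.σ j y) - f (S.σ j x) : ℝ) : ℂ) := by
      rw [ha, hb]; push_cast; ring
    rw [h2, H, add_mul, mul_assoc]
    refine (norm_add_le _ _).trans (add_le_add ?_ ?_)
    · rw [Complex.norm_real, Real.norm_eq_abs, abs_sub_comm]
      exact S.distortion j x y
    · rw [norm_mul, Complex.norm_real]
      refine mul_le_mul_of_nonneg_left ?_ (norm_nonneg _)
      rw [norm_sub_rev]
      exact (f.norm_sub_le _ _).trans
        (mul_le_mul_of_nonneg_left (S.dist_σ_le j x y) f.lipConst_nonneg)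
  have hw' : ‖b - a‖ ≤ S.H f z :=
    hw.trans (mul_le_of_le_one_right (S.H_nonneg f z) (S.dist_le_one x y))
  have h3 : ‖Complex.exp (b - a) - 1‖ ≤ S.H f z * Real.exp (S.H f z) * dist x y := by
    have h4 := Complex.norm_exp_sub_sum_le_norm_mul_exp (b - a) 1
    simp only [Finset.range_one, Finset.sum_singleton, pow_zero, Nat.factorial_zero, Nat.cast_one,
      div_one, pow_one] at h4
    calc ‖Complex.exp (b - a) - 1‖ ≤ ‖b - a‖ * Real.exp ‖b - a‖ := h4
      _ ≤ (S.H f z * dist x y) * Real.exp (S.H f z) :=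
          mul_le_mul hw (Real.exp_le_exp.2 hw') (Real.exp_pos _).le
            (mul_nonneg (S.H_nonneg f z) dist_nonneg)
      _ = _ := by ring
  rw [h1, norm_neg, norm_mul]
  exact mul_le_mul (S.norm_weight_le f z x j) h3 (norm_nonneg _) (by positivity)

theorem norm_term_sub_le (f : Lip X ℝ) (z : ℂ) (u : Lip X ℂ) (x y : X) (j : J) :
    ‖S.term f z u x j - S.term f z u y j‖ ≤ Real.exp (S.φ j x) *
      (Real.exp (‖z‖ * f.supNorm) *
        (u.lipConst + S.H f z * Real.exp (S.H f z) * u.supNorm) * dist x y) := by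
  set A := Complex.exp ((S.φ j x : ℂ) + z * (f (S.σ j x) : ℂ)) with hA
  set A' := Complex.exp ((S.φ j y : ℂ) + z * (f (S.σ j y) : ℂ)) with hA'
  have h1 : S.term f z u x j - S.term f z u y j =
      A * (u (S.σ j x) - u (S.σ j y)) + (A - A') * u (S.σ j y) := by
    simp only [term, ← hA, ← hA']; ring
  have h2 : ‖A * (u (S.σ j x) - u (S.σ j y))‖ ≤
      Real.exp (S.φ j x) * Real.exp (‖z‖ * f.supNorm) * (u.lipConst * dist x y) := by
    rw [norm_mul]
    refine mul_le_mul (S.norm_weight_le f z x j) ?_ (norm_nonneg _) (by positivity)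
    exact (u.norm_sub_le _ _).trans
      (mul_le_mul_of_nonneg_left (S.dist_σ_le j x y) u.lipConst_nonneg)
  have h3 : ‖(A - A') * u (S.σ j y)‖ ≤
      Real.exp (S.φ j x) * Real.exp (‖z‖ * f.supNorm) *
        (S.H f z * Real.exp (S.H f z) * dist x y) * u.supNorm := by
    rw [norm_mul]
    have := S.H_nonneg f z
    exact mul_le_mul (S.norm_weight_sub_le f z x y j) (u.norm_apply_le _) (norm_nonneg _)
      (by positivity)
  rw [h1]
  refine (norm_add_le _ _).trans ((add_le_add h2 h3).trans (le_of_eq ?_))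
  ring

/-- The supremum over `x` of `∑ j, e^{φ_j(x)}`. -/
def M : ℝ := ⨆ x, ∑' j, Real.exp (S.φ j x)

theorem tsum_le_M (x : X) : ∑' j, Real.exp (S.φ j x) ≤ S.M :=
  le_ciSup (f := fun x => ∑' j, Real.exp (S.φ j x)) S.bddAbove_weights x

theorem M_nonneg : 0 ≤ S.M :=
  Real.iSup_nonneg fun _ => tsum_nonneg fun _ => (Real.exp_pos _).le

theorem norm_tsum_term_le (f : Lip X ℝ) (z : ℂ) (u : Lip X ℂ) (x : X) :
    ‖∑' j, S.term f z u x j‖ ≤ S.M * (Real.exp (‖z‖ * f.supNorm) * u.supNorm) := by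
  have := u.supNorm_nonneg
  refine (tsum_of_norm_bounded ((S.summable_weights x).hasSum.mul_right _)
    (S.norm_term_le f z u x)).trans ?_
  exact mul_le_mul_of_nonneg_right (S.tsum_le_M x) (by positivity)

theorem norm_tsum_term_sub_le (f : Lip X ℝ) (z : ℂ) (u : Lip X ℂ) (x y : X) :
    ‖∑' j, S.term f z u x j - ∑' j, S.term f z u y j‖ ≤
      S.M * (Real.exp (‖z‖ * f.supNorm) *
        (u.lipConst + S.H f z * Real.exp (S.H f z) * u.supNorm)) * dist x y := by
  have h1 := u.supNorm_nonneg
  have h2 := u.lipConst_nonneg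
  have h3 := S.H_nonneg f z
  rw [← (S.summable_term f z u x).tsum_sub (S.summable_term f z u y), mul_assoc]
  refine (tsum_of_norm_bounded ((S.summable_weights x).hasSum.mul_right _)
    (S.norm_term_sub_le f z u x y)).trans ?_
  exact mul_le_mul_of_nonneg_right (S.tsum_le_M x) (by positivity)

/-- The perturbed transfer operator `L(z)` as a bounded operator on `Lip(X; ℂ)`:
`(L(z) u)(x) = ∑_j e^{φ_j(x) + z f(σ_j x)} u(σ_j x)`. -/
def transferOp (f : Lip X ℝ) (z : ℂ) : Lip X ℂ →L[ℂ] Lip X ℂ :=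
  LinearMap.mkContinuous
    { toFun := fun u => ⟨fun x => ∑' j, S.term f z u x j,
        ⟨_, S.norm_tsum_term_le f z u⟩, ⟨_, S.norm_tsum_term_sub_le f z u⟩⟩
      map_add' := fun u v => Lip.ext fun x => by
        change ∑' j, S.term f z (u + v) x j = ∑' j, S.term f z u x j + ∑' j, S.term f z v x j
        rw [← (S.summable_term f z u x).tsum_add (S.summable_term f z v x)]
        simp only [term, Lip.add_apply, mul_add]
      map_smul' := fun c u => Lip.ext fun x => by
        change ∑' j, S.term f z (c • u) x j = c * ∑' j, S.term f z u x j
        rw [← tsum_mul_left]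
        refine tsum_congr fun j => ?_
        simp only [term, Lip.smul_apply, smul_eq_mul]
        ring }
    (S.M * (Real.exp (‖z‖ * f.supNorm) * (2 + S.H f z * Real.exp (S.H f z))))
    (fun u => by
      have h1 := u.supNorm_nonneg
      have h2 := u.lipConst_nonneg
      have h3 := S.H_nonneg f z
      have h4 := S.M_nonneg
      rw [Lip.norm_def]
      refine (add_le_add
        (Lip.supNorm_le (by positivity) fun x => S.norm_tsum_term_le f z u x)
        (Lip.lipConst_le (by positivity) fun x y => S.norm_tsum_term_sub_le f z u x y)).trans ?_
      rw [Lip.norm_def, ← mul_add, ← mul_add, mul_assoc S.M, mul_assoc (Real.exp (‖z‖ * f.supNorm))]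
      refine mul_le_mul_of_nonneg_left (mul_le_mul_of_nonneg_left ?_ (Real.exp_pos _).le) h4
      have h5 : 0 ≤ S.H f z * Real.exp (S.H f z) * u.lipConst := by positivity
      nlinarith)

theorem transferOp_apply (f : Lip X ℝ) (z : ℂ) (u : Lip X ℂ) (x : X) :
    S.transferOp f z u x =
      ∑' j, Complex.exp ((S.φ j x : ℂ) + z * (f (S.σ j x) : ℂ)) * u (S.σ j x) := rfl

end Operators

/-! ### Constants and cones -/

section Cones

variable {X J : Type*} [MetricSpace X] (S : BranchSystem X J)

/-- The constant `B = (γ G + 1) / (γ - 1)`. -/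
def B : ℝ := (S.γ * S.G + 1) / (S.γ - 1)

/-- The constant
`D_ℝ = 2 (γ² G + 1) / (γ (γ - 1)) + 2 log ((2 γ² G + γ + 1) / (γ - 1))`. -/
def D : ℝ :=
  2 * (S.γ ^ 2 * S.G + 1) / (S.γ * (S.γ - 1)) +
    2 * Real.log ((2 * S.γ ^ 2 * S.G + S.γ + 1) / (S.γ - 1))

/-- The real cone of all real Lipschitz `u` with `u(x) ≤ e^{B d(x,y)} u(y)` for all `x, y`. -/
def realCone : Set (Lip X ℝ) :=
  {u | ∀ x y : X, 0 ≤ Real.exp (S.B * dist x y) * u y - u x}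

end Cones

end BranchSystem

/-- The dual cone of a set `K` of real Lipschitz functions: the continuous real linear functionals
that are nonnegative on `K`. -/
def realDualCone {X : Type*} [MetricSpace X] (K : Set (Lip X ℝ)) : Set (Lip X ℝ →L[ℝ] ℝ) :=
  {l | ∀ u ∈ K, 0 ≤ l u}

/-- The complex linear extension of a real functional, evaluated at `w = Re w + i Im w`. -/
def complexEval {X : Type*} [MetricSpace X] (l : Lip X ℝ →L[ℝ] ℝ) (w : Lip X ℂ) : ℂ :=
  (l w.re : ℂ) + Complex.I * (l w.im : ℂ)

/-- The canonical complexification of a real cone `K`, without the zero function: all `w ≠ 0` with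
`Re (⟨l₁, w⟩ * conj ⟨l₂, w⟩) ≥ 0` for all `l₁`, `l₂` in the dual cone of `K`. -/
def complexCone {X : Type*} [MetricSpace X] (K : Set (Lip X ℝ)) : Set (Lip X ℂ) :=
  {w | w ≠ 0 ∧ ∀ l₁ ∈ realDualCone K, ∀ l₂ ∈ realDualCone K,
    0 ≤ (complexEval l₁ w * (starRingEnd ℂ) (complexEval l₂ w)).re}

/-- The dual complement of a complex cone: the continuous linear functionals without zeros on it. -/
def dualComplement {V : Type*} [NormedAddCommGroup V] [NormedSpace ℂ V] (C : Set V) :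
    Set (V →L[ℂ] ℂ) :=
  {ν | ∀ w ∈ C, ν w ≠ 0}

/-- `μ` is a simple eigenvalue of the bounded operator `A`: the eigenspace `ker (A - μ)` is a line,
and it is complementary to the range of `A - μ` (no generalized eigenvectors). On a Banach space this
says that `μ` is an isolated point of the spectrum whose spectral projection has rank one. -/
def IsSimpleEigenvalue {V : Type*} [NormedAddCommGroup V] [NormedSpace ℂ V]
    (A : V →L[ℂ] V) (μ : ℂ) : Prop :=
  Module.finrank ℂ (LinearMap.ker ((A : V →ₗ[ℂ] V) - μ • LinearMap.id)) = 1 ∧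
    IsCompl (LinearMap.ker ((A : V →ₗ[ℂ] V) - μ • LinearMap.id))
      (LinearMap.range ((A : V →ₗ[ℂ] V) - μ • LinearMap.id))

end ExpandingMaps

end

/-! The argument is a Perron–Frobenius theorem for complex cones that uses no projective metric. Let
`P` map a complex cone `C` into itself so that `P w` may still be moved by a definite multiple of an
interior point `e`. If a functional takes the same value on `P ^ N` of two cone elements, the same
multiple of `e` can be subtracted from both images under the first application of `P`. Their
difference is unchanged, while the value of the functional drops by the factor `coneRate < 1`. By
induction (`norm_pow_sub_pow_le`) normalized orbits approach each other geometrically. Hence the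
normalized iterates of `e` converge to an eigenvector and the normalized pullbacks of `m` converge
to a dual eigenvector. Every vector is a difference of two cone elements, so the normalized powers
of `P` converge in norm to a rank one operator. Simplicity and the spectral gap follow by splitting
off that operator. All rates depend only on `ρ`, `K`, `t`, so for a holomorphic family the limits
are uniform in the parameter and therefore holomorphic.

It remains to verify the cone condition for the transfer operators (`transferOp_sub_mem`).
Membership in the complexification can be tested on the functionals `gen x y`, and each member is a
unimodular multiple of `p + i q` with `p`, `q` in the real cone. At parameter `0` the operator sends
the real cone with constant `B` into the one with constant `B' = B - γ⁻¹`, a set of projective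
diameter at most `D`. Consequently the mixed products of generator values of the images of `p` and
`q` are at most `cosh (D / 2)` times the pure ones (`cross_le_cosh_mul`). Switching on `z` changes
each generator value by a relative error of at most `exp (‖z‖ (‖f‖_∞ + |f|_ℓ)) - 1`
(`norm_pertOp_gen_sub_le`). Below the threshold `1 / (3 (1 + cosh (D / 2)))` this error cannot
destroy the acute angles, and enough room is left to move in the direction of the constant `1`. -/

noncomputable section

open Filter Topology

namespace ExpandingMaps

/-! ### Strict contractions of complex cones -/

section AbstractCone

variable {V : Type*} [NormedAddCommGroup V] [NormedSpace ℂ V]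

/-- The operator `P` maps the complex cone `C` uniformly into its interior: `e` is an interior point
of `C`, the functional `m` dominates the norm on `C`, and `P w` may be moved in the direction of `e`
by a fixed multiple of `‖m (P w)‖` without leaving `C`. -/
structure IsConeContraction (C : Set V) (e : V) (m : V →L[ℂ] ℂ) (ρ K t : ℝ)
    (P : V →L[ℂ] V) : Prop where
  ρ_pos : 0 < ρ
  K_pos : 0 < K
  t_pos : 0 < t
  zero_notMem : (0 : V) ∉ C
  smul_mem : ∀ w ∈ C, ∀ a : ℂ, a ≠ 0 → a • w ∈ C
  isClosed : IsClosed (insert 0 C)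
  interior : ∀ x : V, ‖x‖ ≤ ρ → e + x ∈ C
  norm_le : ∀ w ∈ C, ‖w‖ ≤ K * ‖m w‖
  map_sub_mem : ∀ w ∈ C, ∀ s : ℂ, ‖s‖ ≤ t * ‖m (P w)‖ → P w - s • e ∈ C

/-- The contraction rate of a strict cone contraction. -/
def coneRate (ρ K t : ℝ) : ℝ := 1 - min (t * ρ / K) (1 / 2)

/-- The iterates of `e`, normalized by the functional `m`. -/
def coneIterate (P : V →L[ℂ] V) (e : V) (m : V →L[ℂ] ℂ) (n : ℕ) : V :=
  (m ((P ^ n) e))⁻¹ • (P ^ n) e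

/-- The pullbacks of `m`, normalized by their value at `e`. -/
def coneDualIterate (P : V →L[ℂ] V) (e : V) (m : V →L[ℂ] ℂ) (n : ℕ) : V →L[ℂ] ℂ :=
  (m ((P ^ n) e))⁻¹ • m.comp (P ^ n)

theorem pow_succ_apply' (P : V →L[ℂ] V) (n : ℕ) (w : V) : (P ^ (n + 1)) w = (P ^ n) (P w) := by
  rw [pow_succ]; rfl

theorem pow_succ_apply (P : V →L[ℂ] V) (n : ℕ) (w : V) : (P ^ (n + 1)) w = P ((P ^ n) w) := by
  rw [pow_succ']; rfl

theorem pow_add_apply (P : V →L[ℂ] V) (n k : ℕ) (w : V) :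
    (P ^ (n + k)) w = (P ^ n) ((P ^ k) w) := by
  rw [pow_add]; rfl

theorem exists_limit_of_geometric_tail {E : Type*} [NormedAddCommGroup E] [CompleteSpace E]
    {a : ℕ → E} {A q : ℝ} (hq0 : 0 ≤ q) (hq1 : q < 1)
    (h : ∀ n k, ‖a n - a (n + k)‖ ≤ A * q ^ n) : ∃ l : E, ∀ n, ‖a n - l‖ ≤ A * q ^ n := by
  have h0 : Tendsto (fun n : ℕ => A * q ^ n) atTop (𝓝 0) := by
    simpa using (tendsto_pow_atTop_nhds_zero_of_lt_one hq0 hq1).const_mul A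
  have hc : CauchySeq a := by
    refine cauchySeq_of_le_tendsto_0' (fun n => A * q ^ n) (fun n k hnk => ?_) h0
    obtain ⟨k, rfl⟩ := Nat.exists_eq_add_of_le hnk
    rw [dist_eq_norm]
    exact h n k
  obtain ⟨l, hl⟩ := cauchySeq_tendsto_of_complete hc
  refine ⟨l, fun n => ?_⟩
  have h1 : Tendsto (fun k => ‖a n - a (k + n)‖) atTop (𝓝 ‖a n - l‖) :=
    ((hl.comp (tendsto_add_atTop_nat n)).const_sub (a n)).norm
  exact le_of_tendsto h1 (Eventually.of_forall fun k => by rw [add_comm]; exact h n k)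

theorem tendsto_of_norm_sub_le_geometric {E : Type*} [NormedAddCommGroup E]
    {a : ℕ → E} {l : E} {A q : ℝ} (hq0 : 0 ≤ q) (hq1 : q < 1)
    (h : ∀ n, ‖a n - l‖ ≤ A * q ^ n) : Tendsto a atTop (𝓝 l) := by
  have h0 : Tendsto (fun n : ℕ => A * q ^ n) atTop (𝓝 0) := by
    simpa using (tendsto_pow_atTop_nhds_zero_of_lt_one hq0 hq1).const_mul A
  exact tendsto_iff_norm_sub_tendsto_zero.2
    (squeeze_zero (fun n => norm_nonneg _) h h0)

namespace IsConeContraction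

variable {C : Set V} {e : V} {m : V →L[ℂ] ℂ} {ρ K t : ℝ} {P : V →L[ℂ] V}

section Basic

variable (H : IsConeContraction C e m ρ K t P)
include H

theorem min_pos : 0 < min (t * ρ / K) (1 / 2) :=
  lt_min (div_pos (mul_pos H.t_pos H.ρ_pos) H.K_pos) (by norm_num)

theorem coneRate_lt_one : coneRate ρ K t < 1 := by
  have := H.min_pos
  unfold coneRate; linarith

theorem e_mem : e ∈ C := by
  simpa using H.interior 0 (by simpa using H.ρ_pos.le)

theorem map_mem {w : V} (hw : w ∈ C) : P w ∈ C := by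
  simpa using H.map_sub_mem w hw 0 (by simpa using mul_nonneg H.t_pos.le (norm_nonneg _))

theorem pow_mem {w : V} (hw : w ∈ C) (n : ℕ) : (P ^ n) w ∈ C := by
  induction n with
  | zero => simpa using hw
  | succ n ih => rw [pow_succ_apply]; exact H.map_mem ih

theorem m_ne_zero {w : V} (hw : w ∈ C) : m w ≠ 0 := by
  intro h
  have h1 := H.norm_le w hw
  rw [h, norm_zero, mul_zero] at h1
  exact H.zero_notMem (norm_le_zero_iff.1 h1 ▸ hw)

theorem m_mem_dualComplement : m ∈ dualComplement C := fun _ hw => H.m_ne_zero hw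

theorem comp_pow_mem_dualComplement {μ : V →L[ℂ] ℂ} (hμ : μ ∈ dualComplement C) (n : ℕ) :
    μ.comp (P ^ n) ∈ dualComplement C := fun _ hw => hμ _ (H.pow_mem hw n)

/-- Were `μ x` larger, `e - (μ e / μ x) • x` would lie in the ball of radius `ρ` about `e`, hence in
`C`, although `μ` vanishes on it. -/
theorem norm_dual_apply_le {μ : V →L[ℂ] ℂ} (hμ : μ ∈ dualComplement C) (x : V) :
    ‖μ x‖ ≤ ρ⁻¹ * ‖x‖ * ‖μ e‖ := by
  by_contra! hlt
  have hρ := H.ρ_pos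
  have hx : 0 < ‖μ x‖ := lt_of_le_of_lt (by positivity) hlt
  have hx0 : μ x ≠ 0 := norm_pos_iff.1 hx
  refine hμ _ (H.interior (-(μ e / μ x) • x) ?_) ?_
  · rw [norm_smul, norm_neg, norm_div, div_mul_eq_mul_div, div_le_iff₀ hx]
    calc ‖μ e‖ * ‖x‖ = ρ * (ρ⁻¹ * ‖x‖ * ‖μ e‖) := by field_simp
      _ ≤ ρ * ‖μ x‖ := mul_le_mul_of_nonneg_left hlt.le hρ.le
  · rw [map_add, map_smul, smul_eq_mul]
    field_simp
    ring

/-- Were `μ (P w)` smaller, the shift with `s = μ (P w) / μ e` would be admissible, and `μ` would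
vanish on the resulting element of `C`. -/
theorem le_norm_dual_map {μ : V →L[ℂ] ℂ} (hμ : μ ∈ dualComplement C) {w : V} (hw : w ∈ C) :
    t * ‖m (P w)‖ * ‖μ e‖ ≤ ‖μ (P w)‖ := by
  have he : μ e ≠ 0 := hμ _ H.e_mem
  by_contra! hlt
  refine hμ _ (H.map_sub_mem w hw (μ (P w) / μ e) ?_) ?_
  · rw [norm_div, div_le_iff₀ (norm_pos_iff.2 he)]
    exact hlt.le
  · rw [map_sub, map_smul, smul_eq_mul]
    field_simp
    ring

/-- This is the shift that drives the contraction: it multiplies the value of `μ` at `P w` by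
`coneRate`. The factor `t * ρ / K` makes it admissible, since `μ (P w) / μ e` is at most `ρ⁻¹ K ‖m
(P w)‖`; the cap `1 / 2` keeps the rate positive. -/
theorem map_sub_dual_mem {μ : V →L[ℂ] ℂ} (hμ : μ ∈ dualComplement C) {w : V} (hw : w ∈ C) :
    P w - (((min (t * ρ / K) (1 / 2) : ℝ) : ℂ) * (μ (P w) / μ e)) • e ∈ C := by
  have he : 0 < ‖μ e‖ := norm_pos_iff.2 (hμ _ H.e_mem)
  have hρ := H.ρ_pos
  have hK := H.K_pos
  have ht := H.t_pos
  refine H.map_sub_mem w hw _ ?_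
  have h1 : ‖μ (P w) / μ e‖ ≤ ρ⁻¹ * (K * ‖m (P w)‖) := by
    rw [norm_div, div_le_iff₀ he]
    refine (H.norm_dual_apply_le hμ _).trans ?_
    gcongr
    exact H.norm_le _ (H.map_mem hw)
  have h2 : ‖((min (t * ρ / K) (1 / 2) : ℝ) : ℂ)‖ ≤ t * ρ / K := by
    rw [Complex.norm_real, Real.norm_of_nonneg H.min_pos.le]
    exact min_le_left _ _
  have h3 := mul_le_mul h2 h1 (norm_nonneg _) (by positivity)
  rw [← norm_mul] at h3
  refine h3.trans (le_of_eq ?_)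
  field_simp

end Basic

theorem coneRate_pos (ρ K t : ℝ) : 0 < coneRate ρ K t := by
  have : min (t * ρ / K) (1 / 2) ≤ (1 / 2 : ℝ) := min_le_right _ _
  unfold coneRate; linarith

/-! ### Geometric contraction of normalized orbits and dual orbits -/

section Contraction

variable (H : IsConeContraction C e m ρ K t P)
include H

/-- With `μ = m ∘ P ^ N`, the values of `μ` at `P w` and `P w'` agree, so `map_sub_dual_mem`
subtracts the same multiple of `e` from both. The difference is unaffected, and the induction
hypothesis, applied to the shifted vectors, gains one factor `coneRate`. -/
theorem norm_pow_sub_pow_le (N : ℕ) : ∀ w ∈ C, ∀ w' ∈ C, m ((P ^ N) w) = m ((P ^ N) w') →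
    ‖(P ^ N) w - (P ^ N) w'‖ ≤ 2 * K * coneRate ρ K t ^ N * ‖m ((P ^ N) w)‖ := by
  induction N with
  | zero =>
    intro w hw w' hw' h
    simp only [pow_zero, one_apply_eq_self] at h ⊢
    have h1 := H.norm_le w hw
    have h2 := H.norm_le w' hw'
    rw [← h] at h2
    have h3 := norm_sub_le w w'
    linarith
  | succ N ih =>
    intro w hw w' hw' h
    set μ := m.comp (P ^ N) with hμdef
    have hμ : μ ∈ dualComplement C := H.comp_pow_mem_dualComplement H.m_mem_dualComplement N
    have he : μ e ≠ 0 := hμ _ H.e_mem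
    set c : ℝ := min (t * ρ / K) (1 / 2) with hc
    have hq : (1 - (c : ℂ)) = ((coneRate ρ K t : ℝ) : ℂ) := by
      rw [coneRate, ← hc]; push_cast; rfl
    have hval : ∀ v, m ((P ^ N) v) = μ v := fun v => rfl
    have hr : ∀ v, μ (P v - ((c : ℂ) * (μ (P v) / μ e)) • e) = coneRate ρ K t * μ (P v) := by
      intro v
      rw [map_sub, map_smul, smul_eq_mul, ← hq]
      field_simp
    rw [pow_succ_apply', pow_succ_apply', hval, hval] at h
    have h1 := ih _ (H.map_sub_dual_mem hμ hw) _ (H.map_sub_dual_mem hμ hw') (by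
      rw [hval, hval]
      have a1 := hr w
      have a2 := hr w'
      rw [hc] at a1 a2
      rw [a1, a2, h])
    rw [hval] at h1
    have a1 := hr w
    rw [hc] at a1
    rw [a1, norm_mul, Complex.norm_real, Real.norm_of_nonneg (coneRate_pos ρ K t).le, h,
      ← map_sub, sub_sub_sub_cancel_right, map_sub] at h1
    rw [pow_succ_apply', pow_succ_apply', hval, h]
    refine h1.trans (le_of_eq ?_)
    rw [pow_succ]; ring

theorem norm_normalized_sub_le (N : ℕ) {w w' : V} (hw : w ∈ C) (hw' : w' ∈ C) :
    ‖(m ((P ^ N) w))⁻¹ • (P ^ N) w - (m ((P ^ N) w'))⁻¹ • (P ^ N) w'‖ ≤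
      2 * K * coneRate ρ K t ^ N := by
  have h1 := H.m_ne_zero (H.pow_mem hw N)
  have h2 := H.m_ne_zero (H.pow_mem hw' N)
  have h3 := H.norm_pow_sub_pow_le N _ (H.smul_mem w hw _ (inv_ne_zero h1))
    _ (H.smul_mem w' hw' _ (inv_ne_zero h2))
    (by simp only [map_smul, smul_eq_mul]; rw [inv_mul_cancel₀ h1, inv_mul_cancel₀ h2])
  simp only [map_smul, smul_eq_mul] at h3
  rw [inv_mul_cancel₀ h1, norm_one, mul_one] at h3
  exact h3

theorem m_coneIterate (n : ℕ) : m (coneIterate P e m n) = 1 := by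
  rw [coneIterate, map_smul, smul_eq_mul, inv_mul_cancel₀ (H.m_ne_zero (H.pow_mem H.e_mem n))]

theorem coneIterate_mem (n : ℕ) : coneIterate P e m n ∈ C :=
  H.smul_mem _ (H.pow_mem H.e_mem n) _ (inv_ne_zero (H.m_ne_zero (H.pow_mem H.e_mem n)))

omit H in
theorem coneIterate_add (n k : ℕ) : coneIterate P e m (n + k) =
    (m ((P ^ n) ((P ^ k) e)))⁻¹ • (P ^ n) ((P ^ k) e) := by
  rw [coneIterate, pow_add_apply]

theorem norm_coneIterate_sub_le (n k : ℕ) :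
    ‖coneIterate P e m n - coneIterate P e m (n + k)‖ ≤ 2 * K * coneRate ρ K t ^ n := by
  rw [coneIterate_add]
  exact H.norm_normalized_sub_le n H.e_mem (H.pow_mem H.e_mem k)

theorem map_coneIterate (n : ℕ) :
    P (coneIterate P e m n) = m (P (coneIterate P e m n)) • coneIterate P e m (n + 1) := by
  have h1 := H.m_ne_zero (H.pow_mem H.e_mem n)
  have h2 := H.m_ne_zero (H.pow_mem H.e_mem (n + 1))
  simp only [coneIterate, map_smul, smul_eq_mul, ← pow_succ_apply, smul_smul]
  congr 1
  field_simp

theorem coneDualIterate_e (n : ℕ) : coneDualIterate P e m n e = 1 := by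
  change (m ((P ^ n) e))⁻¹ * m ((P ^ n) e) = 1
  rw [inv_mul_cancel₀ (H.m_ne_zero (H.pow_mem H.e_mem n))]

theorem coneDualIterate_mem (n : ℕ) : coneDualIterate P e m n ∈ dualComplement C := by
  intro w hw
  change (m ((P ^ n) e))⁻¹ * m ((P ^ n) w) ≠ 0
  exact mul_ne_zero (inv_ne_zero (H.m_ne_zero (H.pow_mem H.e_mem n)))
    (H.m_ne_zero (H.pow_mem hw n))

theorem coneDualIterate_comp (n : ℕ) : (coneDualIterate P e m n).comp P =
    m (P (coneIterate P e m n)) • coneDualIterate P e m (n + 1) := by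
  have h1 := H.m_ne_zero (H.pow_mem H.e_mem n)
  have h2 := H.m_ne_zero (H.pow_mem H.e_mem (n + 1))
  ext w
  change (m ((P ^ n) e))⁻¹ * m ((P ^ n) (P w)) =
    m (P ((m ((P ^ n) e))⁻¹ • (P ^ n) e)) * ((m ((P ^ (n + 1)) e))⁻¹ * m ((P ^ (n + 1)) w))
  rw [map_smul, map_smul, smul_eq_mul, ← pow_succ_apply, ← pow_succ_apply']
  field_simp

/-- On the cone, the normalized dual iterates converge geometrically. -/
theorem norm_coneDualIterate_sub_apply_le_of_mem (n k : ℕ) {w : V} (hw : w ∈ C) :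
    ‖coneDualIterate P e m (n + 1) w - coneDualIterate P e m (n + 1 + k) w‖ ≤
      2 * K * ρ⁻¹ * t⁻¹ * ρ⁻¹ * coneRate ρ K t ^ (n + 1) * ‖w‖ := by
  have hρ := H.ρ_pos
  have hK := H.K_pos
  have ht := H.t_pos
  have hq := coneRate_pos ρ K t
  set N := n + 1 with hN
  set μ := m.comp (P ^ k) with hμdef
  have hμ : μ ∈ dualComplement C := H.comp_pow_mem_dualComplement H.m_mem_dualComplement k
  -- The functional `coneDualIterate (N + k)` differs from `coneDualIterate N` on `w` only by the
  -- relative amount `μ d / μ (coneIterate N)`, where `d` is the small difference of two normalized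
  -- orbits.
  have he : μ (coneIterate P e m N) ≠ 0 := hμ _ (H.coneIterate_mem N)
  have hw0 := H.m_ne_zero (H.pow_mem hw N)
  have he0 := H.m_ne_zero (H.pow_mem H.e_mem N)
  set d := (m ((P ^ N) w))⁻¹ • (P ^ N) w - coneIterate P e m N with hd
  have hdle : ‖d‖ ≤ 2 * K * coneRate ρ K t ^ N := H.norm_normalized_sub_le N hw H.e_mem
  -- The index `N = n + 1` matters here: the lower bound needs a vector in the image `P C`.
  have hlow : t * ‖μ e‖ ≤ ‖μ (coneIterate P e m N)‖ := by
    have h := H.le_norm_dual_map hμ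
      (H.smul_mem _ (H.pow_mem H.e_mem n) _ (inv_ne_zero he0))
    rw [map_smul, hN, ← pow_succ_apply] at h
    have h' : m (coneIterate P e m (n + 1)) = 1 := H.m_coneIterate _
    rw [coneIterate] at h'
    rw [h', norm_one, mul_one] at h
    exact h
  have hfun : coneDualIterate P e m (N + k) w =
      coneDualIterate P e m N w * (1 + μ d / μ (coneIterate P e m N)) := by
    have h1 : 1 + μ d / μ (coneIterate P e m N) =
        (m ((P ^ N) w))⁻¹ * μ ((P ^ N) w) / μ (coneIterate P e m N) := by
      rw [hd, map_sub, map_smul, smul_eq_mul]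
      field_simp
      ring
    rw [h1]
    have h2 : μ (coneIterate P e m N) = (m ((P ^ N) e))⁻¹ * m ((P ^ (N + k)) e) := by
      rw [coneIterate, map_smul, smul_eq_mul, add_comm N k, pow_add_apply P k N]; rfl
    have h3 : μ ((P ^ N) w) = m ((P ^ (N + k)) w) := by
      rw [add_comm N k, pow_add_apply P k N]; rfl
    have h4 : m ((P ^ (N + k)) e) ≠ 0 := H.m_ne_zero (H.pow_mem H.e_mem _)
    rw [h2, h3]
    change (m ((P ^ (N + k)) e))⁻¹ * m ((P ^ (N + k)) w) = (m ((P ^ N) e))⁻¹ * m ((P ^ N) w) * _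
    field_simp
  have hratio : ‖μ d / μ (coneIterate P e m N)‖ ≤ 2 * K * coneRate ρ K t ^ N * ρ⁻¹ * t⁻¹ := by
    have he' : 0 < ‖μ e‖ := norm_pos_iff.2 (hμ _ H.e_mem)
    rw [norm_div, div_le_iff₀ (norm_pos_iff.2 he)]
    calc ‖μ d‖ ≤ ρ⁻¹ * ‖d‖ * ‖μ e‖ := H.norm_dual_apply_le hμ d
      _ ≤ ρ⁻¹ * (2 * K * coneRate ρ K t ^ N) * ‖μ e‖ := by gcongr
      _ = 2 * K * coneRate ρ K t ^ N * ρ⁻¹ * t⁻¹ * (t * ‖μ e‖) := by field_simp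
      _ ≤ _ := by gcongr
  have hval : ‖coneDualIterate P e m N w‖ ≤ ρ⁻¹ * ‖w‖ := by
    have := H.norm_dual_apply_le (H.coneDualIterate_mem N) w
    rwa [H.coneDualIterate_e, norm_one, mul_one] at this
  have hsub : coneDualIterate P e m N w - coneDualIterate P e m (N + k) w =
      -(coneDualIterate P e m N w * (μ d / μ (coneIterate P e m N))) := by
    rw [hfun]; ring
  rw [hsub, norm_neg, norm_mul]
  calc _ ≤ ρ⁻¹ * ‖w‖ * (2 * K * coneRate ρ K t ^ N * ρ⁻¹ * t⁻¹) := by gcongr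
    _ = _ := by ring

theorem smul_e_mem {x : V} (hx : x ≠ 0) : ((ρ⁻¹ * ‖x‖ : ℝ) : ℂ) • e ∈ C := by
  have hx' := norm_pos_iff.2 hx
  have hρ := H.ρ_pos
  exact H.smul_mem _ H.e_mem _ (Complex.ofReal_ne_zero.2 (by positivity))

/-- Together with `smul_e_mem` this writes any `x ≠ 0` as a difference of two cone elements of norm
comparable to `‖x‖`. -/
theorem smul_e_add_mem {x : V} (hx : x ≠ 0) : ((ρ⁻¹ * ‖x‖ : ℝ) : ℂ) • e + x ∈ C := by
  have hx' := norm_pos_iff.2 hx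
  have hρ := H.ρ_pos
  have h0 : ((ρ⁻¹ * ‖x‖ : ℝ) : ℂ) ≠ 0 := Complex.ofReal_ne_zero.2 (by positivity)
  have h1 := H.smul_mem _ (H.interior ((((ρ⁻¹ * ‖x‖ : ℝ) : ℂ))⁻¹ • x) (by
    rw [norm_smul, norm_inv, Complex.norm_real, Real.norm_of_nonneg (by positivity)]
    field_simp
    rfl)) _ h0
  rwa [smul_add, smul_smul, mul_inv_cancel₀ h0, one_smul] at h1

/-- A bound for a linear map on the cone extends to the whole space. -/
theorem norm_apply_le_of_cone {E : Type*} [NormedAddCommGroup E] [NormedSpace ℂ E]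
    (T : V →L[ℂ] E) {A : ℝ} (hA : 0 ≤ A) (h : ∀ w ∈ C, ‖T w‖ ≤ A * ‖w‖) (x : V) :
    ‖T x‖ ≤ A * (2 * ρ⁻¹ * ‖e‖ + 1) * ‖x‖ := by
  rcases eq_or_ne x 0 with rfl | hx
  · simp
  have hρ := H.ρ_pos
  have hn : ‖((ρ⁻¹ * ‖x‖ : ℝ) : ℂ) • e‖ = ρ⁻¹ * ‖x‖ * ‖e‖ := by
    rw [norm_smul, Complex.norm_real, Real.norm_of_nonneg (by positivity)]
  have h1 := h _ (H.smul_e_mem hx)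
  have h2 := h _ (H.smul_e_add_mem hx)
  have h3 := norm_add_le (((ρ⁻¹ * ‖x‖ : ℝ) : ℂ) • e) x
  have h4 : T x = T (((ρ⁻¹ * ‖x‖ : ℝ) : ℂ) • e + x) - T (((ρ⁻¹ * ‖x‖ : ℝ) : ℂ) • e) := by
    rw [map_add]; abel
  rw [hn] at h1 h3
  rw [h4]
  calc _ ≤ A * (ρ⁻¹ * ‖x‖ * ‖e‖ + ‖x‖) + A * (ρ⁻¹ * ‖x‖ * ‖e‖) :=
        (norm_sub_le _ _).trans (add_le_add (h2.trans (by gcongr)) h1)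
    _ = _ := by ring

/-- The constant in the geometric convergence of the normalized dual iterates. -/
def _root_.ExpandingMaps.dualConst (e : V) (ρ K t : ℝ) : ℝ :=
  2 * K * ρ⁻¹ * t⁻¹ * ρ⁻¹ * (2 * ρ⁻¹ * ‖e‖ + 1)

theorem norm_coneDualIterate_sub_le (n k : ℕ) :
    ‖coneDualIterate P e m (n + 1) - coneDualIterate P e m (n + 1 + k)‖ ≤
      dualConst e ρ K t * coneRate ρ K t ^ (n + 1) := by
  have hρ := H.ρ_pos
  have hK := H.K_pos
  have ht := H.t_pos
  have hq := coneRate_pos ρ K t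
  refine ContinuousLinearMap.opNorm_le_bound _ (by unfold dualConst; positivity) fun x => ?_
  refine (H.norm_apply_le_of_cone _ (by positivity)
    (fun w hw => H.norm_coneDualIterate_sub_apply_le_of_mem n k hw) x).trans (le_of_eq ?_)
  rw [dualConst]; ring

/-- Limits of the normalized iterates and dual iterates. -/
theorem exists_limits [CompleteSpace V] : ∃ (h : V) (ν : V →L[ℂ] ℂ),
    (∀ n, ‖coneIterate P e m n - h‖ ≤ 2 * K * coneRate ρ K t ^ n) ∧
    ∀ n, ‖coneDualIterate P e m (n + 1) - ν‖ ≤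
      dualConst e ρ K t * coneRate ρ K t * coneRate ρ K t ^ n := by
  obtain ⟨h, hh⟩ := exists_limit_of_geometric_tail (coneRate_pos ρ K t).le H.coneRate_lt_one
    H.norm_coneIterate_sub_le
  obtain ⟨ν, hν⟩ := exists_limit_of_geometric_tail (coneRate_pos ρ K t).le H.coneRate_lt_one
    (a := fun n => coneDualIterate P e m (n + 1))
    (A := dualConst e ρ K t * coneRate ρ K t) (fun n k => by
      refine (le_of_eq ?_).trans ((H.norm_coneDualIterate_sub_le n k).trans (le_of_eq ?_))
      · rw [add_right_comm]
      · rw [pow_succ]; ring)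
  exact ⟨h, ν, hh, hν⟩

/-! ### Eigenvectors obtained as limits, and convergence to a rank one operator -/

section Limits

variable {h : V} {ν : V →L[ℂ] ℂ}

theorem m_limit (hh : Tendsto (coneIterate P e m) atTop (𝓝 h)) : m h = 1 := by
  have h1 := (m.continuous.tendsto h).comp hh
  have h2 : m ∘ coneIterate P e m = fun _ => 1 := funext fun n => H.m_coneIterate n
  rw [h2] at h1
  exact tendsto_nhds_unique h1 tendsto_const_nhds

theorem limit_mem (hh : Tendsto (coneIterate P e m) atTop (𝓝 h)) : h ∈ C := by
  rcases H.isClosed.mem_of_tendsto hh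
    (Eventually.of_forall fun n => Set.mem_insert_of_mem _ (H.coneIterate_mem n)) with h0 | h0
  · have := H.m_limit hh
    rw [h0, map_zero] at this
    exact absurd this zero_ne_one
  · exact h0

theorem map_limit (hh : Tendsto (coneIterate P e m) atTop (𝓝 h)) : P h = m (P h) • h := by
  have h1 := (P.continuous.tendsto h).comp hh
  have h2 := ((m.continuous.tendsto _).comp h1).smul (hh.comp (tendsto_add_atTop_nat 1))
  refine tendsto_nhds_unique h1 (h2.congr fun n => ?_)
  exact (H.map_coneIterate n).symm

theorem eigenvalue_ne_zero (hh : Tendsto (coneIterate P e m) atTop (𝓝 h)) : m (P h) ≠ 0 :=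
  H.m_ne_zero (H.map_mem (H.limit_mem hh))

omit H in
theorem tendsto_dual_apply
    (hν : Tendsto (fun n => coneDualIterate P e m (n + 1)) atTop (𝓝 ν)) (x : V) :
    Tendsto (fun n => coneDualIterate P e m (n + 1) x) atTop (𝓝 (ν x)) :=
  ((ContinuousLinearMap.apply ℂ ℂ x).continuous.tendsto ν).comp hν

theorem dual_limit_e (hν : Tendsto (fun n => coneDualIterate P e m (n + 1)) atTop (𝓝 ν)) :
    ν e = 1 := by
  refine tendsto_nhds_unique (tendsto_dual_apply hν e) ?_
  simp only [H.coneDualIterate_e]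
  exact tendsto_const_nhds

theorem dual_limit_map (hh : Tendsto (coneIterate P e m) atTop (𝓝 h))
    (hν : Tendsto (fun n => coneDualIterate P e m (n + 1)) atTop (𝓝 ν)) (x : V) :
    ν (P x) = m (P h) * ν x := by
  have h1 := ((m.comp P).continuous.tendsto h).comp (hh.comp (tendsto_add_atTop_nat 1))
  have h2 := h1.mul ((tendsto_dual_apply hν x).comp (tendsto_add_atTop_nat 1))
  refine tendsto_nhds_unique (tendsto_dual_apply hν (P x)) (h2.congr fun n => ?_)
  exact (DFunLike.congr_fun (H.coneDualIterate_comp (n + 1)) x).symm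

theorem le_norm_dual_limit_map
    (hν : Tendsto (fun n => coneDualIterate P e m (n + 1)) atTop (𝓝 ν)) {w : V} (hw : w ∈ C) :
    t * ‖m (P w)‖ ≤ ‖ν (P w)‖ := by
  refine ge_of_tendsto (tendsto_dual_apply hν (P w)).norm (Eventually.of_forall fun n => ?_)
  have := H.le_norm_dual_map (H.coneDualIterate_mem (n + 1)) hw
  rwa [H.coneDualIterate_e, norm_one, mul_one] at this

/-- A limit of functionals without zeros on `C` could acquire zeros. This is excluded by the lower
bound `t * ‖m (P w)‖ ≤ ‖ν (P w)‖`, because `ν (P w)` is a multiple of `ν w`. -/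
theorem dual_limit_mem (hh : Tendsto (coneIterate P e m) atTop (𝓝 h))
    (hν : Tendsto (fun n => coneDualIterate P e m (n + 1)) atTop (𝓝 ν)) :
    ν ∈ dualComplement C := by
  intro w hw h0
  have h1 := H.le_norm_dual_limit_map hν hw
  rw [H.dual_limit_map hh hν, h0, mul_zero, norm_zero] at h1
  have h2 := norm_pos_iff.2 (H.m_ne_zero (H.map_mem hw))
  have := mul_pos H.t_pos h2
  linarith

theorem pow_limit (hh : Tendsto (coneIterate P e m) atTop (𝓝 h)) (n : ℕ) :
    (P ^ n) h = m (P h) ^ n • h := by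
  induction n with
  | zero => simp
  | succ n ih =>
    rw [pow_succ_apply, ih, map_smul, pow_succ, mul_smul, ← H.map_limit hh]

theorem dual_limit_pow (hh : Tendsto (coneIterate P e m) atTop (𝓝 h))
    (hν : Tendsto (fun n => coneDualIterate P e m (n + 1)) atTop (𝓝 ν)) (n : ℕ) (x : V) :
    ν ((P ^ n) x) = m (P h) ^ n * ν x := by
  induction n with
  | zero => simp
  | succ n ih => rw [pow_succ_apply, H.dual_limit_map hh hν, ih, pow_succ]; ring

/-- Geometric convergence of the normalized powers of `P` to the rank one spectral projection. -/
theorem exists_norm_pow_sub_le (hh : Tendsto (coneIterate P e m) atTop (𝓝 h))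
    (hν : Tendsto (fun n => coneDualIterate P e m (n + 1)) atTop (𝓝 ν)) :
    ∃ A : ℝ, ∀ (n : ℕ) (x : V),
      ‖(P ^ (n + 1)) x - (m (P h) ^ (n + 1) * (ν h)⁻¹ * ν x) • h‖ ≤
        A * (coneRate ρ K t * ‖m (P h)‖) ^ (n + 1) * ‖x‖ := by
  set q := coneRate ρ K t with hqdef
  set lam := m (P h) with hlam
  have hq : 0 < q := coneRate_pos ρ K t
  have hK := H.K_pos
  have ht := H.t_pos
  have hmh := H.m_limit hh
  have hhC := H.limit_mem hh
  have hlam0 : lam ≠ 0 := H.eigenvalue_ne_zero hh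
  have hνh : ν h ≠ 0 := H.dual_limit_mem hh hν _ hhC
  have key : ∀ (n : ℕ), ∀ w ∈ C,
      ‖(P ^ (n + 1)) w - (lam ^ (n + 1) * (ν h)⁻¹ * ν w) • h‖ ≤
        2 * K * t⁻¹ * ‖ν‖ * (1 + ‖ν‖ * ‖(ν h)⁻¹‖ * ‖h‖) * (q * ‖lam‖) ^ (n + 1) * ‖w‖ := by
    intro n w hw
    set N := n + 1 with hN
    set a := m ((P ^ N) w) with ha
    have ha0 : a ≠ 0 := H.m_ne_zero (H.pow_mem hw N)
    have h1 : ‖(P ^ N) w - a • h‖ ≤ 2 * K * q ^ N * ‖a‖ := by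
      have h2 := H.norm_normalized_sub_le N hw hhC
      rw [H.pow_limit hh, map_smul, hmh, smul_eq_mul, mul_one, smul_smul,
        inv_mul_cancel₀ (pow_ne_zero _ hlam0), one_smul] at h2
      have h3 : (P ^ N) w - a • h = a • (a⁻¹ • (P ^ N) w - h) := by
        rw [smul_sub, smul_smul, mul_inv_cancel₀ ha0, one_smul]
      rw [h3, norm_smul, mul_comm]
      exact mul_le_mul_of_nonneg_right h2 (norm_nonneg _)
    have hνd : ν ((P ^ N) w - a • h) = lam ^ N * ν w - a * ν h := by
      rw [map_sub, H.dual_limit_pow hh hν, map_smul, smul_eq_mul]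
    -- Applying `ν` to the error `(P ^ N) w - a • h` compares `a` with the correct coefficient `lam
    -- ^ N * ν w / ν h`, so exchanging the two costs only a multiple of that error.
    have h4 : (P ^ N) w - (lam ^ N * (ν h)⁻¹ * ν w) • h =
        ((P ^ N) w - a • h) - (ν ((P ^ N) w - a • h) * (ν h)⁻¹) • h := by
      rw [hνd, sub_sub, ← add_smul]
      congr 2
      field_simp
      ring
    -- The lower bound for `ν` on `P C` controls `m` by `ν`, whose growth under `P` is exactly that
    -- of the powers of `lam`.
    have h5 : ‖a‖ ≤ t⁻¹ * (‖lam‖ ^ N * (‖ν‖ * ‖w‖)) := by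
      have h6 := H.le_norm_dual_limit_map hν (H.pow_mem hw n)
      rw [← pow_succ_apply, H.dual_limit_pow hh hν, norm_mul, norm_pow] at h6
      rw [le_inv_mul_iff₀ ht]
      refine h6.trans ?_
      gcongr
      exact ν.le_opNorm w
    rw [h4]
    calc _ ≤ ‖(P ^ N) w - a • h‖ + ‖ν‖ * ‖(P ^ N) w - a • h‖ * ‖(ν h)⁻¹‖ * ‖h‖ := by
          refine (norm_sub_le _ _).trans (add_le_add le_rfl ?_)
          rw [norm_smul, norm_mul]
          gcongr
          exact ν.le_opNorm _
      _ = ‖(P ^ N) w - a • h‖ * (1 + ‖ν‖ * ‖(ν h)⁻¹‖ * ‖h‖) := by ring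
      _ ≤ (2 * K * q ^ N * (t⁻¹ * (‖lam‖ ^ N * (‖ν‖ * ‖w‖)))) *
          (1 + ‖ν‖ * ‖(ν h)⁻¹‖ * ‖h‖) := by
          gcongr
          exact h1.trans (by gcongr)
      _ = _ := by rw [mul_pow]; ring
  refine ⟨2 * K * t⁻¹ * ‖ν‖ * (1 + ‖ν‖ * ‖(ν h)⁻¹‖ * ‖h‖) * (2 * ρ⁻¹ * ‖e‖ + 1), fun n x => ?_⟩
  have h1 := H.norm_apply_le_of_cone
    (P ^ (n + 1) - (lam ^ (n + 1) * (ν h)⁻¹) • ν.smulRight h)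
    (A := 2 * K * t⁻¹ * ‖ν‖ * (1 + ‖ν‖ * ‖(ν h)⁻¹‖ * ‖h‖) * (q * ‖lam‖) ^ (n + 1))
    (by positivity) (fun w hw => by
      refine (le_of_eq ?_).trans (key n w hw)
      rw [mul_smul _ (ν w)]; rfl) x
  refine (le_of_eq ?_).trans (h1.trans (le_of_eq ?_))
  · rw [mul_smul _ (ν x)]; rfl
  · ring

end Limits

end Contraction

end IsConeContraction

/-! ### Spectral gap -/

section SpectralGap

variable {P : V →L[ℂ] V} {h : V} {ν : V →L[ℂ] ℂ} {lam : ℂ} {A q : ℝ}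

theorem eigenvector_eq_of_norm_pow_sub_le (hlam : lam ≠ 0) (hq0 : 0 ≤ q) (hq1 : q < 1)
    (hA : ∀ (n : ℕ) (x : V), ‖(P ^ (n + 1)) x - (lam ^ (n + 1) * ν x) • h‖ ≤
      A * (q * ‖lam‖) ^ (n + 1) * ‖x‖) {x : V} (hx : P x = lam • x) : x = ν x • h := by
  have hpow : ∀ n, (P ^ n) x = lam ^ n • x := by
    intro n
    induction n with
    | zero => simp
    | succ n ih => rw [pow_succ_apply, ih, map_smul, hx, smul_smul, ← pow_succ]
  have h1 : ∀ n : ℕ, ‖x - ν x • h‖ ≤ A * ‖x‖ * q * q ^ n := by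
    intro n
    have h2 := hA n x
    rw [hpow, mul_smul, ← smul_sub, norm_smul, mul_pow, norm_pow] at h2
    have h3 : 0 < ‖lam‖ ^ (n + 1) := pow_pos (norm_pos_iff.2 hlam) _
    refine le_of_mul_le_mul_left (h2.trans (le_of_eq ?_)) h3
    rw [pow_succ q]; ring
  have h0 : Tendsto (fun n : ℕ => A * ‖x‖ * q * q ^ n) atTop (𝓝 0) := by
    simpa using (tendsto_pow_atTop_nhds_zero_of_lt_one hq0 hq1).const_mul (A * ‖x‖ * q)
  have h4 := ge_of_tendsto h0 (Eventually.of_forall h1)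
  exact sub_eq_zero.1 (norm_le_zero_iff.1 h4)

/-- The operator `P` without its leading rank one part. -/
def deflation (P : V →L[ℂ] V) (h : V) (ν : V →L[ℂ] ℂ) (lam : ℂ) : V →L[ℂ] V :=
  P - lam • ν.smulRight h

theorem deflation_apply (x : V) : deflation P h ν lam x = P x - (lam * ν x) • h := by
  rw [mul_smul]; rfl

theorem dual_deflation (hνh : ν h = 1) (hν : ∀ x, ν (P x) = lam * ν x) (x : V) :
    ν (deflation P h ν lam x) = 0 := by
  rw [deflation_apply, map_sub, hν, map_smul, hνh, smul_eq_mul, mul_one, sub_self]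

/-- The rank one part commutes with `P` and the deflation annihilates it, so no mixed terms appear
in the powers. -/
theorem deflation_pow_apply (hνh : ν h = 1) (hh : P h = lam • h) (hν : ∀ x, ν (P x) = lam * ν x)
    (n : ℕ) (x : V) :
    (deflation P h ν lam ^ (n + 1)) x = (P ^ (n + 1)) x - (lam ^ (n + 1) * ν x) • h := by
  have hpow : ∀ n, ν ((P ^ n) x) = lam ^ n * ν x := by
    intro n
    induction n with
    | zero => simp
    | succ n ih => rw [pow_succ_apply, hν, ih, pow_succ]; ring
  induction n with
  | zero => simpa using deflation_apply x
  | succ n ih =>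
    rw [pow_succ_apply, ih, deflation_apply, map_sub, map_sub, hpow, map_smul, map_smul, hνh, hh,
      ← pow_succ_apply, smul_smul, smul_eq_mul, sub_sub, ← add_smul]
    congr 2
    ring

/-- This is the spectral radius estimate: the powers of the deflation are bounded by a constant
times `(q * ‖lam‖) ^ n`, and `μ ^ n` lies in the spectrum of the `n`-th power. -/
theorem norm_le_of_mem_spectrum_deflation [CompleteSpace V] (hνh : ν h = 1) (hh : P h = lam • h)
    (hν : ∀ x, ν (P x) = lam * ν x) (hq0 : 0 ≤ q)
    (hA : ∀ (n : ℕ) (x : V), ‖(P ^ (n + 1)) x - (lam ^ (n + 1) * ν x) • h‖ ≤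
      A * (q * ‖lam‖) ^ (n + 1) * ‖x‖) {μ : ℂ} (hμ : μ ∈ spectrum ℂ (deflation P h ν lam)) :
    ‖μ‖ ≤ q * ‖lam‖ := by
  have h0 : 0 ≤ q * ‖lam‖ := mul_nonneg hq0 (norm_nonneg _)
  have h1 : ∀ n : ℕ, ‖μ‖ ^ (n + 1) ≤
      |A| * ‖(1 : V →L[ℂ] V)‖ * (q * ‖lam‖) ^ (n + 1) := by
    intro n
    have h2 := spectrum.norm_le_norm_mul_of_mem (spectrum.pow_mem_pow _ (n + 1) hμ)
    rw [norm_pow] at h2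
    have h3 : ‖deflation P h ν lam ^ (n + 1)‖ ≤ |A| * (q * ‖lam‖) ^ (n + 1) :=
      ContinuousLinearMap.opNorm_le_bound _ (by positivity) fun x => by
        rw [deflation_pow_apply hνh hh hν]
        refine (hA n x).trans ?_
        gcongr
        exact le_abs_self A
    calc _ ≤ _ := h2
      _ ≤ |A| * (q * ‖lam‖) ^ (n + 1) * ‖(1 : V →L[ℂ] V)‖ := by gcongr
      _ = _ := by ring
  by_contra! hlt
  have hμ0 : 0 < ‖μ‖ := lt_of_le_of_lt h0 hlt
  set s := q * ‖lam‖ / ‖μ‖ with hs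
  have hs0 : 0 ≤ s := div_nonneg h0 hμ0.le
  have hs1 : s < 1 := (div_lt_one hμ0).2 hlt
  have h4 : ∀ n : ℕ, 1 ≤ |A| * ‖(1 : V →L[ℂ] V)‖ * s * s ^ n := by
    intro n
    have h5 : q * ‖lam‖ = s * ‖μ‖ := by rw [hs]; field_simp
    have h6 := h1 n
    rw [h5, mul_pow] at h6
    refine le_of_mul_le_mul_right (le_trans (by rw [one_mul]) (h6.trans (le_of_eq ?_)))
      (pow_pos hμ0 (n + 1))
    rw [pow_succ s]; ring
  have h7 : Tendsto (fun n : ℕ => |A| * ‖(1 : V →L[ℂ] V)‖ * s * s ^ n) atTop (𝓝 0) := by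
    simpa using (tendsto_pow_atTop_nhds_zero_of_lt_one hs0 hs1).const_mul
      (|A| * ‖(1 : V →L[ℂ] V)‖ * s)
  have := ge_of_tendsto h7 (Eventually.of_forall h4)
  linarith

theorem spectrum_diff_subset_of_norm_pow_sub_le [CompleteSpace V] (hνh : ν h = 1)
    (hh : P h = lam • h) (hν : ∀ x, ν (P x) = lam * ν x) (hq0 : 0 ≤ q)
    (hA : ∀ (n : ℕ) (x : V), ‖(P ^ (n + 1)) x - (lam ^ (n + 1) * ν x) • h‖ ≤
      A * (q * ‖lam‖) ^ (n + 1) * ‖x‖) :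
    spectrum ℂ P \ {lam} ⊆ Metric.closedBall 0 (q * ‖lam‖) := by
  rintro μ ⟨hμ, hne⟩
  rw [mem_closedBall_zero_iff]
  by_contra! hlt
  have hμ0 : μ ≠ 0 := norm_pos_iff.1
    (lt_of_le_of_lt (mul_nonneg hq0 (norm_nonneg _)) hlt)
  have hμlam : μ - lam ≠ 0 := sub_ne_zero.2 hne
  have hres : μ ∉ spectrum ℂ (deflation P h ν lam) := fun hmem =>
    absurd (norm_le_of_mem_spectrum_deflation hνh hh hν hq0 hA hmem) (not_le.2 hlt)
  obtain ⟨R, hR⟩ := spectrum.notMem_iff.1 hres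
  have hRl : ∀ x, R.1 ((R⁻¹).1 x) = x := fun x => DFunLike.congr_fun R.mul_inv x
  have hRr : ∀ x, (R⁻¹).1 (R.1 x) = x := fun x => DFunLike.congr_fun R.inv_mul x
  have hRa : ∀ x, R.1 x = μ • x - (P x - (lam * ν x) • h) := fun x => by
    rw [hR, ← deflation_apply, Algebra.algebraMap_eq_smul_one]; rfl
  have hRh : (R⁻¹).1 h = μ⁻¹ • h := by
    have h1 : R.1 (μ⁻¹ • h) = h := by
      rw [map_smul, hRa, hνh, hh, mul_one, sub_self, sub_zero, smul_smul, inv_mul_cancel₀ hμ0,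
        one_smul]
    rw [← hRr (μ⁻¹ • h), h1]
  have hνR : ∀ x, ν ((R⁻¹).1 x) = μ⁻¹ * ν x := fun x => by
    have h1 := congrArg ν (hRl x)
    rw [hRa, map_sub, map_sub, map_smul, map_smul, hν, hνh] at h1
    simp only [smul_eq_mul] at h1
    rw [← h1]
    field_simp
    ring
  refine spectrum.mem_iff.1 hμ ?_
  -- The deflation kills `h` and is killed by `ν`, so its resolvent acts on the line through `h` as
  -- `μ⁻¹`. The resolvent of `P` must act there as `(μ - lam)⁻¹`, and a rank one correction
  -- suffices.
  set T : V →L[ℂ] V := (R⁻¹).1 + ((μ - lam)⁻¹ - μ⁻¹) • ν.smulRight h with hT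
  have hTa : ∀ x, T x = (R⁻¹).1 x + (((μ - lam)⁻¹ - μ⁻¹) * ν x) • h := fun x => by
    rw [mul_smul]; rfl
  have hPa : ∀ x, (algebraMap ℂ (V →L[ℂ] V) μ - P) x = R.1 x - (lam * ν x) • h := fun x => by
    rw [hRa, Algebra.algebraMap_eq_smul_one]
    change μ • x - P x = _
    abel
  refine ⟨⟨algebraMap ℂ (V →L[ℂ] V) μ - P, T, ?_, ?_⟩, rfl⟩
  · ext x
    change (algebraMap ℂ (V →L[ℂ] V) μ - P) (T x) = x
    rw [hPa, hTa, map_add, hRl, map_smul, hRa, hνh, hh, map_add, hνR, map_smul, hνh, mul_one,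
      sub_self, sub_zero, smul_smul, add_sub_assoc, ← sub_smul, smul_eq_mul]
    have : ((μ - lam)⁻¹ - μ⁻¹) * ν x * μ - lam * (μ⁻¹ * ν x + ((μ - lam)⁻¹ - μ⁻¹) * ν x * 1) =
        0 := by
      field_simp
      ring
    rw [this, zero_smul, add_zero]
  · ext x
    change T ((algebraMap ℂ (V →L[ℂ] V) μ - P) x) = x
    have h1 : ν (R.1 x) = μ * ν x := by
      have := hνR (R.1 x)
      rw [hRr] at this
      rw [this]; field_simp
    rw [hTa, hPa, map_sub, hRr, map_smul, hRh, map_sub, h1, map_smul, hνh, smul_eq_mul, smul_smul,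
      sub_add, ← sub_smul]
    have : lam * ν x * μ⁻¹ - ((μ - lam)⁻¹ - μ⁻¹) * (μ * ν x - lam * ν x * 1) = 0 := by
      field_simp
      ring
    rw [this, zero_smul, sub_zero]

theorem isSimpleEigenvalue_of_norm_pow_sub_le [CompleteSpace V] (hlam : lam ≠ 0) (hνh : ν h = 1)
    (hh : P h = lam • h) (hν : ∀ x, ν (P x) = lam * ν x) (hq0 : 0 ≤ q) (hq1 : q < 1)
    (hA : ∀ (n : ℕ) (x : V), ‖(P ^ (n + 1)) x - (lam ^ (n + 1) * ν x) • h‖ ≤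
      A * (q * ‖lam‖) ^ (n + 1) * ‖x‖) : IsSimpleEigenvalue P lam := by
  have hh0 : h ≠ 0 := by
    rintro rfl
    rw [map_zero] at hνh
    exact zero_ne_one hνh
  have happ : ∀ x, ((P : V →ₗ[ℂ] V) - lam • (LinearMap.id : V →ₗ[ℂ] V)) x = P x - lam • x := fun x => rfl
  have hker : LinearMap.ker ((P : V →ₗ[ℂ] V) - lam • LinearMap.id) = Submodule.span ℂ {h} := by
    ext x
    rw [LinearMap.mem_ker, happ, sub_eq_zero, Submodule.mem_span_singleton]
    constructor
    · intro hx
      exact ⟨ν x, (eigenvector_eq_of_norm_pow_sub_le hlam hq0 hq1 hA hx).symm⟩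
    · rintro ⟨a, rfl⟩
      rw [map_smul, hh, smul_comm]
  have hrange : LinearMap.range ((P : V →ₗ[ℂ] V) - lam • LinearMap.id) =
      LinearMap.ker (ν : V →ₗ[ℂ] ℂ) := by
    ext x
    rw [LinearMap.mem_ker]
    constructor
    · rintro ⟨y, rfl⟩
      change ν (P y - lam • y) = 0
      rw [map_sub, hν, map_smul, smul_eq_mul, sub_self]
    -- On `ker ν` the operator `P` coincides with its deflation, for which `lam` is a resolvent
    -- point.
    · intro hx
      change ν x = 0 at hx
      have hres : lam ∉ spectrum ℂ (deflation P h ν lam) := fun hmem => by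
        have h1 := norm_le_of_mem_spectrum_deflation hνh hh hν hq0 hA hmem
        have h2 := norm_pos_iff.2 hlam
        nlinarith
      obtain ⟨R, hR⟩ := spectrum.notMem_iff.1 hres
      have hRa : ∀ x, R.1 x = lam • x - deflation P h ν lam x := fun x => by
        rw [hR, Algebra.algebraMap_eq_smul_one]; rfl
      set y := (R⁻¹).1 x
      have hy : lam • y - deflation P h ν lam y = x := by
        rw [← hRa]; exact DFunLike.congr_fun R.mul_inv x
      have hνy : ν y = 0 := by
        have h1 := congrArg ν hy
        rw [map_sub, dual_deflation hνh hν, hx, sub_zero, map_smul, smul_eq_mul] at h1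
        exact (mul_eq_zero.1 h1).resolve_left hlam
      refine ⟨-y, ?_⟩
      rw [happ, map_neg, ← hy, deflation_apply, hνy, mul_zero, zero_smul, sub_zero, smul_neg]
      abel
  refine ⟨by rw [hker, finrank_span_singleton hh0], ?_⟩
  rw [hker, hrange]
  constructor
  · rw [Submodule.disjoint_def]
    intro x hx hx'
    obtain ⟨a, rfl⟩ := Submodule.mem_span_singleton.1 hx
    change ν (a • h) = 0 at hx'
    rw [map_smul, hνh, smul_eq_mul, mul_one] at hx'
    rw [hx', zero_smul]
  · rw [codisjoint_iff, eq_top_iff]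
    intro x _
    refine Submodule.mem_sup.2 ⟨ν x • h, Submodule.mem_span_singleton.2 ⟨_, rfl⟩,
      x - ν x • h, ?_, by abel⟩
    change ν (x - ν x • h) = 0
    rw [map_sub, map_smul, hνh, smul_eq_mul, mul_one, sub_self]

end SpectralGap

end AbstractCone

/-! ### Holomorphic families of strict cone contractions -/

section HolomorphicFamily

variable {V : Type*} [NormedAddCommGroup V] [NormedSpace ℂ V]

theorem differentiableOn_of_norm_sub_le_geometric {E : Type*} [NormedAddCommGroup E]
    [NormedSpace ℂ E] [CompleteSpace E] {U : Set ℂ} (hU : IsOpen U) {F : ℕ → ℂ → E} {f : ℂ → E}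
    {A q : ℝ} (hq0 : 0 ≤ q) (hq1 : q < 1) (hF : ∀ n, DifferentiableOn ℂ (F n) U)
    (h : ∀ n, ∀ z ∈ U, ‖F n z - f z‖ ≤ A * q ^ n) : DifferentiableOn ℂ f U := by
  have h0 : Tendsto (fun n : ℕ => A * q ^ n) atTop (𝓝 0) := by
    simpa using (tendsto_pow_atTop_nhds_zero_of_lt_one hq0 hq1).const_mul A
  have hu : TendstoUniformlyOn F f atTop U := by
    rw [Metric.tendstoUniformlyOn_iff]
    intro ε hε
    filter_upwards [h0.eventually (gt_mem_nhds hε)] with n hn z hz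
    rw [dist_comm, dist_eq_norm]
    exact (h n z hz).trans_lt hn
  exact hu.tendstoLocallyUniformlyOn.differentiableOn (Eventually.of_forall hF) hU

theorem differentiable_pow_clm {P : ℂ → V →L[ℂ] V} (hP : Differentiable ℂ P) (n : ℕ) :
    Differentiable ℂ fun z => P z ^ n := by
  induction n with
  | zero => simp only [pow_zero]; exact differentiable_const _
  | succ n ih => simp only [pow_succ]; exact ih.mul hP

/-- A holomorphic family of uniformly strict cone contractions has a holomorphic leading simple
eigenvalue with a spectral gap, and holomorphic left and right eigenvectors. -/
theorem exists_holomorphic_eigendata [CompleteSpace V] {C : Set V} {e : V} {m : V →L[ℂ] ℂ}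
    {ρ K t δ : ℝ} {P : ℂ → V →L[ℂ] V} (hP : Differentiable ℂ P)
    (H : ∀ z : ℂ, ‖z‖ ≤ δ → IsConeContraction C e m ρ K t (P z)) :
    ∃ (h : ℂ → V) (ν : ℂ → (V →L[ℂ] ℂ)) (lam : ℂ → ℂ),
      (∀ z : ℂ, ‖z‖ ≤ δ →
        h z ∈ C ∧ ν z ∈ dualComplement C ∧ lam z ≠ 0 ∧ P z (h z) = lam z • h z ∧
        (ν z).comp (P z) = lam z • ν z ∧ ν z (h z) = 1 ∧ ν z e = 1 ∧
        IsSimpleEigenvalue (P z) (lam z) ∧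
        ∃ r : ℝ, 0 ≤ r ∧ r < ‖lam z‖ ∧ spectrum ℂ (P z) \ {lam z} ⊆ Metric.closedBall 0 r) ∧
      DifferentiableOn ℂ h (Metric.ball 0 δ) ∧
      DifferentiableOn ℂ ν (Metric.ball 0 δ) ∧
      DifferentiableOn ℂ lam (Metric.ball 0 δ) := by
  have hex : ∀ z : ℂ, ∃ (h : V) (ν : V →L[ℂ] ℂ), ‖z‖ ≤ δ →
      (∀ n, ‖coneIterate (P z) e m n - h‖ ≤ 2 * K * coneRate ρ K t ^ n) ∧
      ∀ n, ‖coneDualIterate (P z) e m (n + 1) - ν‖ ≤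
        dualConst e ρ K t * coneRate ρ K t * coneRate ρ K t ^ n := by
    intro z
    by_cases hz : ‖z‖ ≤ δ
    · obtain ⟨h, ν, hh, hν⟩ := (H z hz).exists_limits
      exact ⟨h, ν, fun _ => ⟨hh, hν⟩⟩
    -- Default values outside the disc, where nothing is claimed.
    · exact ⟨0, 0, fun h => absurd h hz⟩
  choose h ν hhν using hex
  have hq0 : 0 ≤ coneRate ρ K t := (IsConeContraction.coneRate_pos ρ K t).le
  have hball : ∀ z ∈ Metric.ball (0 : ℂ) δ, ‖z‖ ≤ δ := fun z hz =>
    (mem_ball_zero_iff.1 hz).le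
  have hm0 : ∀ (n : ℕ), ∀ z ∈ Metric.ball (0 : ℂ) δ, m ((P z ^ n) e) ≠ 0 := fun n z hz =>
    (H z (hball z hz)).m_ne_zero ((H z (hball z hz)).pow_mem (H z (hball z hz)).e_mem n)
  have hpowe : ∀ n : ℕ, Differentiable ℂ fun z => (P z ^ n) e := fun n =>
    (differentiable_pow_clm hP n).clm_apply (differentiable_const e)
  have hmpow : ∀ n : ℕ, Differentiable ℂ fun z => m ((P z ^ n) e) := fun n =>
    m.differentiable.comp (hpowe n)
  have hinv : ∀ n : ℕ, DifferentiableOn ℂ (fun z => (m ((P z ^ n) e))⁻¹) (Metric.ball 0 δ) :=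
    fun n => (hmpow n).differentiableOn.inv (hm0 n)
  have hdiffν : DifferentiableOn ℂ ν (Metric.ball 0 δ) := by
    -- The bound `coneRate < 1` has to come from one member of the family; `z = 0` is available as
    -- soon as the disc is nonempty.
    rcases lt_or_ge 0 δ with hδ | hδ
    · exact differentiableOn_of_norm_sub_le_geometric Metric.isOpen_ball hq0
        (H 0 (by simpa using hδ.le)).coneRate_lt_one
        (F := fun n z => coneDualIterate (P z) e m (n + 1))
        (fun n => (hinv (n + 1)).smul
          ((differentiable_const m).clm_comp (differentiable_pow_clm hP (n + 1))).differentiableOn)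
        (fun n z hz => (hhν z (hball z hz)).2 n)
    · rw [Metric.ball_eq_empty.2 hδ]; exact differentiableOn_empty
  have hdiffh : DifferentiableOn ℂ h (Metric.ball 0 δ) := by
    rcases lt_or_ge 0 δ with hδ | hδ
    · exact differentiableOn_of_norm_sub_le_geometric Metric.isOpen_ball hq0
        (H 0 (by simpa using hδ.le)).coneRate_lt_one
        (F := fun n z => coneIterate (P z) e m n)
        (fun n => (hinv n).smul (hpowe n).differentiableOn)
        (fun n z hz => (hhν z (hball z hz)).1 n)
    · rw [Metric.ball_eq_empty.2 hδ]; exact differentiableOn_empty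
  have hlim : ∀ z, ‖z‖ ≤ δ → Tendsto (coneIterate (P z) e m) atTop (𝓝 (h z)) := fun z hz =>
    tendsto_of_norm_sub_le_geometric hq0 (H z hz).coneRate_lt_one (hhν z hz).1
  have hlimν : ∀ z, ‖z‖ ≤ δ →
      Tendsto (fun n => coneDualIterate (P z) e m (n + 1)) atTop (𝓝 (ν z)) := fun z hz =>
    tendsto_of_norm_sub_le_geometric hq0 (H z hz).coneRate_lt_one (hhν z hz).2
  have hνh : ∀ z, ‖z‖ ≤ δ → ν z (h z) ≠ 0 := fun z hz =>
    (H z hz).dual_limit_mem (hlim z hz) (hlimν z hz) _ ((H z hz).limit_mem (hlim z hz))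
  -- The limit `h z` is normalized by `m`, so it is rescaled to `⟨ν, h⟩ = 1`. The eigenvalue `m (P z
  -- (h z))` is read off before rescaling.
  refine ⟨fun z => (ν z (h z))⁻¹ • h z, ν, fun z => m (P z (h z)), fun z hz => ?_, ?_, hdiffν, ?_⟩
  · have Hz := H z hz
    have hh := hlim z hz
    have hν := hlimν z hz
    have h0 := hνh z hz
    have hlam := Hz.eigenvalue_ne_zero hh
    have hnorm : ν z ((ν z (h z))⁻¹ • h z) = 1 := by
      rw [map_smul, smul_eq_mul, inv_mul_cancel₀ h0]
    have heig : P z ((ν z (h z))⁻¹ • h z) = m (P z (h z)) • (ν z (h z))⁻¹ • h z := by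
      rw [map_smul, smul_comm, ← Hz.map_limit hh]
    have hdual := Hz.dual_limit_map hh hν
    obtain ⟨A, hA⟩ := Hz.exists_norm_pow_sub_le hh hν
    have hA' : ∀ (n : ℕ) (x : V), ‖(P z ^ (n + 1)) x -
        (m (P z (h z)) ^ (n + 1) * ν z x) • (ν z (h z))⁻¹ • h z‖ ≤
          A * (coneRate ρ K t * ‖m (P z (h z))‖) ^ (n + 1) * ‖x‖ := by
      intro n x
      rw [smul_smul, mul_right_comm]
      exact hA n x
    refine ⟨Hz.smul_mem _ (Hz.limit_mem hh) _ (inv_ne_zero h0), Hz.dual_limit_mem hh hν, hlam,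
      heig, ContinuousLinearMap.ext hdual, hnorm, Hz.dual_limit_e hν,
      isSimpleEigenvalue_of_norm_pow_sub_le hlam hnorm heig hdual hq0 Hz.coneRate_lt_one hA',
      coneRate ρ K t * ‖m (P z (h z))‖, by positivity, ?_,
      spectrum_diff_subset_of_norm_pow_sub_le hnorm heig hdual hq0 hA'⟩
    exact mul_lt_of_lt_one_left (norm_pos_iff.2 hlam) Hz.coneRate_lt_one
  · exact ((hdiffν.clm_apply hdiffh).inv fun z hz => hνh z (hball z hz)).smul hdiffh
  · exact m.differentiable.comp_differentiableOn (hP.differentiableOn.clm_apply hdiffh)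

end HolomorphicFamily

/-! ### Completeness of the space of Lipschitz functions -/

namespace Lip

section Complete

variable {X 𝕜 : Type*} [MetricSpace X] [RCLike 𝕜]

theorem supNorm_le_norm (u : Lip X 𝕜) : u.supNorm ≤ ‖u‖ := by
  rw [norm_def]; linarith [u.lipConst_nonneg]

theorem lipConst_le_norm (u : Lip X 𝕜) : u.lipConst ≤ ‖u‖ := by
  rw [norm_def]; linarith [u.supNorm_nonneg]

theorem norm_apply_le_norm (u : Lip X 𝕜) (x : X) : ‖u x‖ ≤ ‖u‖ :=
  (u.norm_apply_le x).trans u.supNorm_le_norm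

/-- Evaluation at a point as a continuous linear functional. -/
def eval (x : X) : Lip X 𝕜 →L[𝕜] 𝕜 :=
  LinearMap.mkContinuous
    { toFun := fun u => u x
      map_add' := fun _ _ => rfl
      map_smul' := fun _ _ => rfl } 1 fun u => by
    rw [one_mul]; exact u.norm_apply_le_norm x

instance : CompleteSpace (Lip X 𝕜) := by
  refine Metric.complete_of_cauchySeq_tendsto fun u hu => ?_
  have hpt : ∀ x, ∃ l, Tendsto (fun n => u n x) atTop (𝓝 l) := fun x =>
    cauchySeq_tendsto_of_complete ((eval (𝕜 := 𝕜) x).uniformContinuous.comp_cauchySeq hu)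
  choose v hv using hpt
  have hC := Metric.cauchySeq_iff.1 hu
  -- Both halves of the Cauchy estimate survive the pointwise limit; this gives membership of the
  -- limit in the space as well as convergence in norm.
  have hsub : ∀ ε > 0, ∃ N, ∀ n ≥ N, (∀ x, ‖u n x - v x‖ ≤ ε) ∧
      ∀ x y, ‖(u n x - v x) - (u n y - v y)‖ ≤ ε * dist x y := by
    intro ε hε
    obtain ⟨N, hN⟩ := hC ε hε
    refine ⟨N, fun n hn => ⟨fun x => ?_, fun x y => ?_⟩⟩
    · refine le_of_tendsto ((hv x).const_sub (u n x)).norm ?_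
      filter_upwards [eventually_ge_atTop N] with k hk
      have h1 := (hN n hn k hk).le
      rw [dist_eq_norm] at h1
      exact ((u n - u k).norm_apply_le_norm x).trans h1
    · refine le_of_tendsto (((hv x).const_sub (u n x)).sub ((hv y).const_sub (u n y))).norm ?_
      filter_upwards [eventually_ge_atTop N] with k hk
      have h1 := (hN n hn k hk).le
      rw [dist_eq_norm] at h1
      refine ((u n - u k).norm_sub_le x y).trans ?_
      exact mul_le_mul_of_nonneg_right ((u n - u k).lipConst_le_norm.trans h1) dist_nonneg
  obtain ⟨N, hN⟩ := hsub 1 one_pos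
  obtain ⟨hb, hl⟩ := hN N le_rfl
  let w : Lip X 𝕜 := ⟨v, ⟨1 + (u N).supNorm, fun x => by
      have h1 : v x = -(u N x - v x) + u N x := by ring
      rw [h1]
      refine (norm_add_le _ _).trans (add_le_add ?_ ((u N).norm_apply_le x))
      rw [norm_neg]; exact hb x⟩,
    ⟨1 + (u N).lipConst, fun x y => by
      have h1 : v x - v y = -((u N x - v x) - (u N y - v y)) + (u N x - u N y) := by ring
      rw [h1, add_mul]
      refine (norm_add_le _ _).trans (add_le_add ?_ ((u N).norm_sub_le x y))
      rw [norm_neg]; exact hl x y⟩⟩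
  refine ⟨w, Metric.tendsto_atTop.2 fun ε hε => ?_⟩
  obtain ⟨N, hN⟩ := hsub (ε / 3) (by positivity)
  refine ⟨N, fun n hn => ?_⟩
  obtain ⟨h1, h2⟩ := hN n hn
  rw [dist_eq_norm, norm_def]
  have h3 : (u n - w).supNorm ≤ ε / 3 := supNorm_le (by positivity) h1
  have h4 : (u n - w).lipConst ≤ ε / 3 := lipConst_le (by positivity) h2
  linarith

end Complete

/-! ### Multiplication operators and their exponentials -/

section Multiplication

variable {X : Type*} [MetricSpace X]

theorem norm_ofReal_mul_le (f : Lip X ℝ) (u : Lip X ℂ) (x : X) :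
    ‖(f x : ℂ) * u x‖ ≤ f.supNorm * u.supNorm := by
  rw [norm_mul, Complex.norm_real]
  exact mul_le_mul (f.norm_apply_le x) (u.norm_apply_le x) (norm_nonneg _) f.supNorm_nonneg

theorem norm_ofReal_mul_sub_le (f : Lip X ℝ) (u : Lip X ℂ) (x y : X) :
    ‖(f x : ℂ) * u x - (f y : ℂ) * u y‖ ≤
      (f.supNorm * u.lipConst + f.lipConst * u.supNorm) * dist x y := by
  have h1 : (f x : ℂ) * u x - (f y : ℂ) * u y =
      (f x : ℂ) * (u x - u y) + ((f x - f y : ℝ) : ℂ) * u y := by push_cast; ring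
  rw [h1, add_mul]
  refine (norm_add_le _ _).trans (add_le_add ?_ ?_)
  · rw [norm_mul, Complex.norm_real, mul_assoc]
    exact mul_le_mul (f.norm_apply_le x) (u.norm_sub_le x y) (norm_nonneg _) f.supNorm_nonneg
  · rw [norm_mul, Complex.norm_real, mul_right_comm]
    exact mul_le_mul (f.norm_sub_le x y) (u.norm_apply_le y) (norm_nonneg _)
      (mul_nonneg f.lipConst_nonneg dist_nonneg)

/-- Multiplication by a real Lipschitz function. -/
def mulReal (f : Lip X ℝ) : Lip X ℂ →L[ℂ] Lip X ℂ :=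
  LinearMap.mkContinuous
    { toFun := fun u => ⟨fun x => (f x : ℂ) * u x, ⟨_, norm_ofReal_mul_le f u⟩,
        ⟨_, norm_ofReal_mul_sub_le f u⟩⟩
      map_add' := fun u v => Lip.ext fun x => mul_add _ _ _
      map_smul' := fun c u => Lip.ext fun x => mul_left_comm _ _ _ }
    (2 * ‖f‖) fun u => by
      have h1 := f.supNorm_nonneg
      have h2 := f.lipConst_nonneg
      have h3 := u.supNorm_nonneg
      have h4 := u.lipConst_nonneg
      rw [norm_def]
      refine (add_le_add (supNorm_le (by positivity) (norm_ofReal_mul_le f u))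
        (lipConst_le (by positivity) (norm_ofReal_mul_sub_le f u))).trans ?_
      rw [norm_def, norm_def]
      nlinarith [mul_nonneg h1 h3, mul_nonneg h1 h4, mul_nonneg h2 h3, mul_nonneg h2 h4]

@[simp] theorem mulReal_apply (f : Lip X ℝ) (u : Lip X ℂ) (x : X) :
    mulReal f u x = (f x : ℂ) * u x := rfl

theorem mulReal_pow_apply (f : Lip X ℝ) (n : ℕ) (u : Lip X ℂ) (x : X) :
    (mulReal f ^ n) u x = (f x : ℂ) ^ n * u x := by
  induction n with
  | zero => simp
  | succ n ih => rw [pow_succ_apply, mulReal_apply, ih, pow_succ]; ring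

/-- Evaluation at `x` is continuous, so it may be applied term by term to the exponential series of
operators. -/
theorem exp_smul_mulReal_apply (f : Lip X ℝ) (z : ℂ) (u : Lip X ℂ) (x : X) :
    NormedSpace.exp (z • mulReal f) u x = Complex.exp (z * f x) * u x := by
  have h1 := NormedSpace.exp_series_hasSum_exp' (𝕂 := ℂ) (z • mulReal f)
  have h2 := ((eval (𝕜 := ℂ) x).comp (ContinuousLinearMap.apply ℂ (Lip X ℂ) u)).hasSum h1
  have h3 : HasSum (fun n : ℕ => ((n.factorial : ℂ)⁻¹ • (z * f x) ^ n))
      (Complex.exp (z * f x)) := by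
    rw [Complex.exp_eq_exp_ℂ]
    exact NormedSpace.exp_series_hasSum_exp' (𝕂 := ℂ) (z * f x)
  refine h2.unique ?_
  refine (h3.mul_right (u x)).congr_fun fun n => ?_
  change eval x ((((n.factorial : ℂ)⁻¹) • (z • mulReal f) ^ n) u) = _
  rw [smul_pow, smul_smul]
  change ((n.factorial : ℂ)⁻¹ * z ^ n) * ((mulReal f ^ n) u x) = _
  rw [mulReal_pow_apply, smul_eq_mul, mul_pow]
  ring

end Multiplication

end Lip

/-- The perturbing factor depends on `x` only through `σ j x`, so it can be absorbed into the
function acted upon. The dependence on `z` then sits in an operator exponential, which is entire. -/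
theorem BranchSystem.transferOp_eq_comp_exp {X J : Type*} [MetricSpace X] (S : BranchSystem X J)
    (f : Lip X ℝ) (z : ℂ) :
    S.transferOp f z = S.transferOp f 0 * NormedSpace.exp (z • Lip.mulReal f) := by
  ext u
  refine Lip.ext fun x => ?_
  change S.transferOp f z u x = S.transferOp f 0 (NormedSpace.exp (z • Lip.mulReal f) u) x
  rw [transferOp_apply, transferOp_apply]
  refine tsum_congr fun j => ?_
  rw [Lip.exp_smul_mulReal_apply, zero_mul, add_zero, Complex.exp_add, mul_assoc]

theorem BranchSystem.differentiable_transferOp {X J : Type*} [MetricSpace X]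
    (S : BranchSystem X J) (f : Lip X ℝ) : Differentiable ℂ (S.transferOp f) := by
  have h1 : S.transferOp f =
      fun z => S.transferOp f 0 * NormedSpace.exp (z • Lip.mulReal f) :=
    funext fun z => S.transferOp_eq_comp_exp f z
  rw [h1]
  exact fun z => ((hasDerivAt_exp_smul_const (Lip.mulReal f) z).differentiableAt).const_mul _

/-! ### Elementary inequalities -/

theorem exp_mul_le_of_mem_Icc {θ : ℝ} (h0 : 0 ≤ θ) (h1 : θ ≤ 1) (x : ℝ) :
    Real.exp (θ * x) ≤ θ * Real.exp x + (1 - θ) := by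
  have h := convexOn_exp.2 (Set.mem_univ x) (Set.mem_univ 0) h0 (sub_nonneg.2 h1) (by ring)
  simpa using h

theorem norm_cexp_sub_one_le (w : ℂ) : ‖Complex.exp w - 1‖ ≤ Real.exp ‖w‖ - 1 := by
  simpa using Complex.norm_exp_sub_sum_le_exp_norm_sub_sum w 1

/-- Pairwise acute complex numbers lie in a common quadrant, up to a rotation. -/
theorem exists_rotation_quadrant {ι : Type*} (a : ι → ℂ)
    (h : ∀ i j, 0 ≤ (a i * (starRingEnd ℂ) (a j)).re) :
    ∃ ζ : ℂ, ‖ζ‖ = 1 ∧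
      ∀ i, 0 ≤ ((starRingEnd ℂ) ζ * a i).re ∧ 0 ≤ ((starRingEnd ℂ) ζ * a i).im := by
  by_cases hz : ∀ i, a i = 0
  · exact ⟨1, by simp, fun i => by simp [hz i]⟩
  push Not at hz
  obtain ⟨i₀, hi₀⟩ := hz
  set b : ι → ℂ := fun i => a i * (starRingEnd ℂ) (a i₀) with hb
  have hπ := Real.pi_pos
  have hconj0 : (starRingEnd ℂ) (a i₀) ≠ 0 := (map_ne_zero _).2 hi₀
  have harg : ∀ i, |(b i).arg| ≤ Real.pi / 2 := fun i => Complex.abs_arg_le_pi_div_two_iff.2 (h i i₀)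
  have hpolar : ∀ i, b i = (‖b i‖ : ℂ) * Complex.exp ((b i).arg * Complex.I) := fun i =>
    (Complex.norm_mul_exp_arg_mul_I (b i)).symm
  -- All arguments lie in `[-π/2, π/2]`, so a difference exceeding `π/2` is at most `π`. Its cosine
  -- would be negative, against the acute angle hypothesis.
  have hdiff : ∀ i j, b i ≠ 0 → b j ≠ 0 → (b i).arg - (b j).arg ≤ Real.pi / 2 := by
    intro i j hi hj
    have h1 : (b i * (starRingEnd ℂ) (b j)).re =
        ‖b i‖ * ‖b j‖ * Real.cos ((b i).arg - (b j).arg) := by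
      conv_lhs => rw [hpolar i, hpolar j]
      rw [map_mul, Complex.conj_ofReal, ← Complex.exp_conj, map_mul, Complex.conj_I,
        Complex.conj_ofReal, mul_mul_mul_comm, ← Complex.exp_add, ← Complex.ofReal_mul,
        Complex.re_ofReal_mul]
      congr 1
      rw [← Complex.exp_ofReal_mul_I_re]
      congr 2
      push_cast
      ring
    have h2 : 0 ≤ (b i * (starRingEnd ℂ) (b j)).re := by
      have h3 : b i * (starRingEnd ℂ) (b j) =
          ((‖a i₀‖ ^ 2 : ℝ) : ℂ) * (a i * (starRingEnd ℂ) (a j)) := by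
        rw [Complex.ofReal_pow, ← Complex.mul_conj']
        simp only [hb, map_mul, Complex.conj_conj]
        ring
      rw [h3, Complex.re_ofReal_mul]
      exact mul_nonneg (by positivity) (h i j)
    rw [h1] at h2
    have h4 : 0 < ‖b i‖ * ‖b j‖ := mul_pos (norm_pos_iff.2 hi) (norm_pos_iff.2 hj)
    by_contra! hlt
    have h5 := Real.cos_neg_of_pi_div_two_lt_of_lt hlt (by
      have := abs_le.1 (harg i); have := abs_le.1 (harg j); linarith)
    nlinarith
  set A : Set ℝ := (fun i => (b i).arg) '' {i | b i ≠ 0} with hA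
  have hne : A.Nonempty := ⟨_, i₀, mul_ne_zero hi₀ hconj0, rfl⟩
  have hbdd : BddBelow A := ⟨-(Real.pi / 2), by
    rintro _ ⟨i, -, rfl⟩
    exact (abs_le.1 (harg i)).1⟩
  -- Rotating the least argument to `0` puts all the numbers in the closed first quadrant.
  set α := sInf A with hα
  have hlo : ∀ i, b i ≠ 0 → α ≤ (b i).arg := fun i hi => csInf_le hbdd ⟨i, hi, rfl⟩
  have hhi : ∀ i, b i ≠ 0 → (b i).arg - Real.pi / 2 ≤ α := fun i hi => by
    refine le_csInf hne ?_
    rintro _ ⟨j, hj, rfl⟩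
    linarith [hdiff i j hi hj]
  have hquad : ∀ i, 0 ≤ (Complex.exp (-(α * Complex.I)) * b i).re ∧
      0 ≤ (Complex.exp (-(α * Complex.I)) * b i).im := by
    intro i
    by_cases hi : b i = 0
    · simp [hi]
    have h1 : Complex.exp (-(α * Complex.I)) * b i =
        (‖b i‖ : ℂ) * Complex.exp ((((b i).arg - α : ℝ) : ℂ) * Complex.I) := by
      conv_lhs => rw [hpolar i]
      rw [mul_left_comm, ← Complex.exp_add]
      congr 2
      push_cast
      ring
    have h2 := hlo i hi
    have h3 := hhi i hi
    rw [h1, Complex.re_ofReal_mul, Complex.im_ofReal_mul, Complex.exp_ofReal_mul_I_re,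
      Complex.exp_ofReal_mul_I_im]
    exact ⟨mul_nonneg (norm_nonneg _) (Real.cos_nonneg_of_mem_Icc ⟨by linarith, by linarith⟩),
      mul_nonneg (norm_nonneg _) (Real.sin_nonneg_of_nonneg_of_le_pi (by linarith) (by linarith))⟩
  have hn : 0 < ‖a i₀‖ := norm_pos_iff.2 hi₀
  refine ⟨Complex.exp (α * Complex.I) * ((‖a i₀‖⁻¹ : ℝ) * a i₀), ?_, fun i => ?_⟩
  · rw [norm_mul, Complex.norm_exp_ofReal_mul_I, one_mul, norm_mul, Complex.norm_real,
      Real.norm_of_nonneg (by positivity), inv_mul_cancel₀ hn.ne']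
  · have h1 : (starRingEnd ℂ) (Complex.exp (α * Complex.I) * ((‖a i₀‖⁻¹ : ℝ) * a i₀)) * a i =
        ((‖a i₀‖⁻¹ : ℝ) : ℂ) * (Complex.exp (-(α * Complex.I)) * b i) := by
      simp only [map_mul, ← Complex.exp_conj, Complex.conj_ofReal, Complex.conj_I, hb, mul_neg]
      ring
    rw [h1, Complex.re_ofReal_mul, Complex.im_ofReal_mul]
    exact ⟨mul_nonneg (by positivity) (hquad i).1, mul_nonneg (by positivity) (hquad i).2⟩

/-- The cross terms of two pairs of nonnegative numbers at finite projective distance. -/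
theorem cross_le_cosh_mul {p₁ p₂ q₁ q₂ D : ℝ} (hp₁ : 0 ≤ p₁) (hp₂ : 0 ≤ p₂) (hq₁ : 0 ≤ q₁)
    (hq₂ : 0 ≤ q₂) (h₁ : p₁ * q₂ ≤ Real.exp D * (q₁ * p₂))
    (h₂ : q₁ * p₂ ≤ Real.exp D * (p₁ * q₂)) :
    p₁ * q₂ + q₁ * p₂ ≤ Real.cosh (D / 2) * (p₁ * p₂ + q₁ * q₂) := by
  have hc := Real.cosh_pos (D / 2)
  have hE : Real.exp D * Real.exp (-D) = 1 := by rw [← Real.exp_add]; simp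
  have hcosh : Real.exp D + Real.exp (-D) + 2 = 4 * Real.cosh (D / 2) ^ 2 := by
    have h := Real.cosh_sq (D / 2)
    have h' := Real.cosh_two_mul (D / 2)
    rw [mul_div_cancel₀ D two_ne_zero, Real.cosh_eq] at h'
    linarith
  set s := p₁ * q₂ with hs
  set t := q₁ * p₂ with ht
  have hs0 : 0 ≤ s := mul_nonneg hp₁ hq₂
  have ht0 : 0 ≤ t := mul_nonneg hq₁ hp₂
  have h2' : Real.exp (-D) * t ≤ s := by
    have := mul_le_mul_of_nonneg_left h₂ (Real.exp_pos (-D)).le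
    nlinarith
  have h3 : (s - Real.exp D * t) * (s - Real.exp (-D) * t) ≤ 0 :=
    mul_nonpos_of_nonpos_of_nonneg (by linarith) (by linarith)
  have h4 : (s + t) ^ 2 ≤ 4 * Real.cosh (D / 2) ^ 2 * (s * t) := by
    rw [← hcosh]
    have h : (s + t) ^ 2 = (Real.exp D + Real.exp (-D) + 2) * (s * t) +
        (s - Real.exp D * t) * (s - Real.exp (-D) * t) +
        (1 - Real.exp D * Real.exp (-D)) * t ^ 2 := by ring
    rw [hE] at h
    linarith
  have h5 : s * t = (p₁ * p₂) * (q₁ * q₂) := by rw [hs, ht]; ring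
  have h6 : 0 ≤ p₁ * p₂ + q₁ * q₂ := by positivity
  refine abs_le_of_sq_le_sq' ?_ (by positivity) |>.2
  rw [h5] at h4
  refine h4.trans ?_
  rw [mul_pow]
  nlinarith [sq_nonneg (p₁ * p₂ - q₁ * q₂), mul_pos hc hc,
    mul_nonneg (mul_pos hc hc).le (sq_nonneg (p₁ * p₂ - q₁ * q₂))]

/-- A perturbation of two vectors of the first quadrant keeps their inner product under control. -/
theorem re_mul_conj_ge {p₁ p₂ q₁ q₂ η : ℝ} {e₁ e₂ : ℂ} (hp₁ : 0 ≤ p₁) (hp₂ : 0 ≤ p₂)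
    (hq₁ : 0 ≤ q₁) (hq₂ : 0 ≤ q₂) (hη : 0 ≤ η) (h₁ : ‖e₁‖ ≤ η * (p₁ + q₁))
    (h₂ : ‖e₂‖ ≤ η * (p₂ + q₂)) :
    p₁ * p₂ + q₁ * q₂ - (2 * η + η ^ 2) * ((p₁ + q₁) * (p₂ + q₂)) ≤
      ((p₁ + Complex.I * q₁ + e₁) * (starRingEnd ℂ) (p₂ + Complex.I * q₂ + e₂)).re := by
  have hn : ∀ p q : ℝ, 0 ≤ p → 0 ≤ q → ‖(p + Complex.I * q : ℂ)‖ ≤ p + q := fun p q hp hq => by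
    refine (norm_add_le _ _).trans ?_
    rw [norm_mul, Complex.norm_I, one_mul, Complex.norm_real, Complex.norm_real,
      Real.norm_of_nonneg hp, Real.norm_of_nonneg hq]
  have hm : ((p₁ + Complex.I * q₁ : ℂ) * (starRingEnd ℂ) (p₂ + Complex.I * q₂ : ℂ)).re =
      p₁ * p₂ + q₁ * q₂ := by
    simp
  have hexp : ((p₁ + Complex.I * q₁ + e₁) * (starRingEnd ℂ) (p₂ + Complex.I * q₂ + e₂) : ℂ) =
      (p₁ + Complex.I * q₁) * (starRingEnd ℂ) (p₂ + Complex.I * q₂) +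
        ((p₁ + Complex.I * q₁) * (starRingEnd ℂ) e₂ +
          e₁ * (starRingEnd ℂ) (p₂ + Complex.I * q₂) + e₁ * (starRingEnd ℂ) e₂) := by
    simp only [map_add]; ring
  rw [hexp, Complex.add_re, hm]
  have hs₁ : 0 ≤ p₁ + q₁ := add_nonneg hp₁ hq₁
  have hs₂ : 0 ≤ p₂ + q₂ := add_nonneg hp₂ hq₂
  have hbound : ‖((p₁ + Complex.I * q₁) * (starRingEnd ℂ) e₂ +
      e₁ * (starRingEnd ℂ) (p₂ + Complex.I * q₂) + e₁ * (starRingEnd ℂ) e₂ : ℂ)‖ ≤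
        (2 * η + η ^ 2) * ((p₁ + q₁) * (p₂ + q₂)) := by
    refine (norm_add_le _ _).trans ((add_le_add (norm_add_le _ _) le_rfl).trans ?_)
    rw [norm_mul, norm_mul, norm_mul, RCLike.norm_conj, RCLike.norm_conj]
    have a1 := mul_le_mul (hn p₁ q₁ hp₁ hq₁) h₂ (norm_nonneg _) hs₁
    have a2 := mul_le_mul h₁ (hn p₂ q₂ hp₂ hq₂) (norm_nonneg _) (mul_nonneg hη hs₁)
    have a3 := mul_le_mul h₁ h₂ (norm_nonneg _) (mul_nonneg hη hs₁)
    linarith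
  have := (abs_le.1 ((Complex.abs_re_le_norm _).trans hbound)).1
  linarith

namespace BranchSystem

variable {X J : Type*} [MetricSpace X] (S : BranchSystem X J)

/-! ### Constants -/

/-- The constant of the smaller cone that contains the image of the real cone. -/
def B' : ℝ := S.B - S.γ⁻¹

theorem γ_pos : 0 < S.γ := zero_lt_one.trans S.one_lt_γ

theorem B'_eq : S.B' = (S.γ ^ 2 * S.G + 1) / (S.γ * (S.γ - 1)) := by
  have h1 := S.γ_pos.ne'
  have h2 : S.γ - 1 ≠ 0 := (sub_pos.2 S.one_lt_γ).ne'
  rw [B', B]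
  field_simp
  ring

theorem B'_pos : 0 < S.B' := by
  have h1 := S.γ_pos
  have h2 := sub_pos.2 S.one_lt_γ
  have h3 := S.G_pos
  rw [B'_eq]; positivity

theorem B_eq : S.B = S.B' + S.γ⁻¹ := by rw [B']; ring

theorem B_pos : 0 < S.B := by
  rw [B_eq]; exact add_pos S.B'_pos (inv_pos.2 S.γ_pos)

/-- One application of the operator turns the constant `B` into `G + B γ⁻¹`. The value of `B` is the
one for which this is smaller than `B` by exactly `γ⁻¹`. -/
theorem G_add_B_div : S.G + S.B * S.γ⁻¹ = S.B' := by
  have h1 := S.γ_pos.ne'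
  have h2 : S.γ - 1 ≠ 0 := (sub_pos.2 S.one_lt_γ).ne'
  rw [B', B]
  field_simp
  ring

/-- The ratio `(B + B') / (B - B')`. -/
def R : ℝ := (2 * S.γ ^ 2 * S.G + S.γ + 1) / (S.γ - 1)

theorem R_eq : S.R = S.γ * (S.B + S.B') := by
  have h1 := S.γ_pos.ne'
  have h2 : S.γ - 1 ≠ 0 := (sub_pos.2 S.one_lt_γ).ne'
  rw [B', B, R]
  field_simp
  ring

theorem R_pos : 0 < S.R := by
  rw [R_eq]; exact mul_pos S.γ_pos (add_pos S.B_pos S.B'_pos)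

theorem exp_D : Real.exp S.D = S.R ^ 2 * Real.exp (2 * S.B') := by
  have h : S.D = 2 * S.B' + (Real.log S.R + Real.log S.R) := by
    rw [D, B'_eq, R]; ring
  rw [h, Real.exp_add, Real.exp_add, Real.exp_log S.R_pos]; ring

/-- Convexity of the exponential between `-(B + B') s` and `0` with weight `R⁻¹ = (B - B') / (B +
B')`, multiplied by `R e^{B s}`. -/
theorem exp_sub_exp_le (s : ℝ) :
    Real.exp (S.B * s) - Real.exp (-(S.B' * s)) ≤
      S.R * (Real.exp (S.B * s) - Real.exp (S.B' * s)) := by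
  have hB := S.B_pos
  have hB' := S.B'_pos
  have hγ := S.γ_pos
  have hR := S.R_pos
  have hsum : 0 < S.B + S.B' := add_pos hB hB'
  have hdiff : S.B - S.B' = S.γ⁻¹ := by rw [B']; ring
  have hRinv : S.R⁻¹ = (S.B - S.B') / (S.B + S.B') := by
    rw [hdiff, R_eq]; field_simp
  have hR1 : S.R⁻¹ ≤ 1 := by
    rw [hRinv, div_le_one hsum]; linarith
  have h1 := exp_mul_le_of_mem_Icc (inv_pos.2 hR).le hR1 (-((S.B + S.B') * s))
  have h2 : S.R⁻¹ * -((S.B + S.B') * s) = S.B' * s - S.B * s := by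
    rw [hRinv]; field_simp; ring
  rw [h2] at h1
  have h3 := mul_le_mul_of_nonneg_left h1 (mul_pos hR (Real.exp_pos (S.B * s))).le
  have h4 : Real.exp (S.B * s) * Real.exp (S.B' * s - S.B * s) = Real.exp (S.B' * s) := by
    rw [← Real.exp_add]; congr 1; ring
  have h5 : Real.exp (S.B * s) * Real.exp (-((S.B + S.B') * s)) = Real.exp (-(S.B' * s)) := by
    rw [← Real.exp_add]; congr 1; ring
  have h6 : S.R * Real.exp (S.B * s) *
      (S.R⁻¹ * Real.exp (-((S.B + S.B') * s)) + (1 - S.R⁻¹)) =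
      Real.exp (-(S.B' * s)) + S.R * Real.exp (S.B * s) - Real.exp (S.B * s) := by
    rw [← h5]; field_simp; ring
  rw [h6, mul_assoc, h4] at h3
  linarith

/-! ### The real cone -/

/-- The generating functionals `u ↦ e^{B d(x, y)} u(y) - u(x)` of the dual cone. -/
def gen (x y : X) : Lip X ℝ →L[ℝ] ℝ :=
  Real.exp (S.B * dist x y) • Lip.eval y - Lip.eval x

theorem gen_apply (x y : X) (u : Lip X ℝ) :
    S.gen x y u = Real.exp (S.B * dist x y) * u y - u x := rfl

theorem gen_mem (x y : X) : S.gen x y ∈ realDualCone S.realCone := fun _ hu => hu x y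

/-- The complex extensions of the generating functionals. -/
def cgen (x y : X) : Lip X ℂ →L[ℂ] ℂ :=
  (Real.exp (S.B * dist x y) : ℂ) • Lip.eval y - Lip.eval x

theorem cgen_apply (x y : X) (w : Lip X ℂ) :
    S.cgen x y w = (Real.exp (S.B * dist x y) : ℂ) * w y - w x := rfl

theorem complexEval_gen (x y : X) (w : Lip X ℂ) : complexEval (S.gen x y) w = S.cgen x y w := by
  rw [complexEval, gen_apply, gen_apply, cgen_apply]
  apply Complex.ext <;> simp [Lip.re, Lip.im, -Complex.ofReal_exp]

theorem gen_re (x y : X) (w : Lip X ℂ) : S.gen x y w.re = (S.cgen x y w).re := by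
  rw [← complexEval_gen]; simp [complexEval]

theorem gen_im (x y : X) (w : Lip X ℂ) : S.gen x y w.im = (S.cgen x y w).im := by
  rw [← complexEval_gen]; simp [complexEval]

theorem _root_.ExpandingMaps.apply_re_smul (l : Lip X ℝ →L[ℝ] ℝ) (c : ℂ) (w : Lip X ℂ) :
    l (c • w).re = (c * complexEval l w).re := by
  have h : (c • w).re = c.re • w.re + (-c.im) • w.im := Lip.ext fun x => by
    change (c * w x).re = c.re * (w x).re + -c.im * (w x).im
    rw [Complex.mul_re]; ring
  rw [h, map_add, map_smul, map_smul, complexEval]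
  simp
  ring

/-- The canonical complexification of the real cone is described by the generators. -/
theorem mem_complexCone_iff (w : Lip X ℂ) : w ∈ complexCone S.realCone ↔
    w ≠ 0 ∧ ∀ x y x' y' : X, 0 ≤ (S.cgen x y w * (starRingEnd ℂ) (S.cgen x' y' w)).re := by
  constructor
  · rintro ⟨h0, h⟩
    refine ⟨h0, fun x y x' y' => ?_⟩
    rw [← complexEval_gen, ← complexEval_gen]
    exact h _ (S.gen_mem x y) _ (S.gen_mem x' y')
  · rintro ⟨h0, h⟩
    -- For a fixed generator, the real part of `conj (cgen x' y' w) • w` is nonnegative on all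
    -- generators, so it lies in the real cone and every dual functional is nonnegative on it.
    -- Repeating this in the other argument replaces the second generator too, without describing
    -- the dual cone.
    have key : ∀ l ∈ realDualCone S.realCone, ∀ x y : X,
        0 ≤ (complexEval l w * (starRingEnd ℂ) (S.cgen x y w)).re := by
      intro l hl x' y'
      rw [mul_comm, ← apply_re_smul]
      refine hl _ fun x y => ?_
      rw [← gen_apply, apply_re_smul, complexEval_gen, mul_comm]
      exact h x y x' y'
    refine ⟨h0, fun l₁ h₁ l₂ h₂ => ?_⟩
    rw [mul_comm, ← apply_re_smul]
    refine h₁ _ fun x y => ?_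
    rw [← gen_apply, apply_re_smul, complexEval_gen, ← Complex.conj_re, map_mul, Complex.conj_conj]
    exact key l₂ h₂ x y

variable {S}

/-- Every element of the complexification is a multiple of some `p + i q`, with `p` and `q` in the
real cone. -/
theorem exists_eq_mul_add_I_mul {w : Lip X ℂ} (hw : w ∈ complexCone S.realCone) :
    ∃ ζ : ℂ, ‖ζ‖ = 1 ∧ ∃ p ∈ S.realCone, ∃ q ∈ S.realCone,
      ∀ x, w x = ζ * (p x + Complex.I * q x) := by
  obtain ⟨ζ, hζ, h⟩ := exists_rotation_quadrant (fun i : X × X => S.cgen i.1 i.2 w)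
    fun i j => ((S.mem_complexCone_iff w).1 hw).2 i.1 i.2 j.1 j.2
  have hcg : ∀ x y, S.cgen x y ((starRingEnd ℂ) ζ • w) = (starRingEnd ℂ) ζ * S.cgen x y w :=
    fun x y => by rw [map_smul, smul_eq_mul]
  refine ⟨ζ, hζ, ((starRingEnd ℂ) ζ • w).re, fun x y => ?_, ((starRingEnd ℂ) ζ • w).im,
    fun x y => ?_, fun x => ?_⟩
  · rw [← gen_apply, gen_re, hcg]
    exact (h (x, y)).1
  · rw [← gen_apply, gen_im, hcg]
    exact (h (x, y)).2
  · have h1 : ((((starRingEnd ℂ) ζ • w).re x : ℝ) : ℂ) +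
        Complex.I * ((((starRingEnd ℂ) ζ • w).im x : ℝ) : ℂ) = (starRingEnd ℂ) ζ * w x := by
      rw [mul_comm]
      exact Complex.re_add_im _
    rw [h1, ← mul_assoc, Complex.mul_conj', hζ]
    simp

section Cone

theorem apply_le_exp_mul {u : Lip X ℝ} (hu : u ∈ S.realCone) (x y : X) :
    u x ≤ Real.exp (S.B * dist x y) * u y := sub_nonneg.1 (hu x y)

variable [Nontrivial X]

/-- Going from `x` to a second point and back gives `u x ≤ e^{2 B d} u x` with `d > 0`, which is
impossible for a negative value. -/
theorem apply_nonneg {u : Lip X ℝ} (hu : u ∈ S.realCone) (x : X) : 0 ≤ u x := by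
  obtain ⟨y, hy⟩ := exists_ne x
  have h1 := apply_le_exp_mul hu x y
  have h2 := apply_le_exp_mul hu y x
  have hd : 0 < S.B * dist x y := mul_pos S.B_pos (dist_pos.2 hy.symm)
  rw [dist_comm y x] at h2
  have h3 : 1 < Real.exp (S.B * dist x y) := Real.one_lt_exp_iff.2 hd
  by_contra! hneg
  have h4 : u x ≤ Real.exp (S.B * dist x y) * (Real.exp (S.B * dist x y) * u x) :=
    h1.trans (mul_le_mul_of_nonneg_left h2 (by positivity))
  rw [← mul_assoc] at h4
  have h5 : 1 < Real.exp (S.B * dist x y) * Real.exp (S.B * dist x y) := by nlinarith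
  nlinarith

theorem apply_le_exp_B_mul {u : Lip X ℝ} (hu : u ∈ S.realCone) (x y : X) :
    u x ≤ Real.exp S.B * u y := by
  refine (apply_le_exp_mul hu x y).trans (mul_le_mul_of_nonneg_right ?_ (apply_nonneg hu y))
  exact Real.exp_le_exp.2 (mul_le_of_le_one_right S.B_pos.le (S.dist_le_one x y))

variable (S) in
omit [Nontrivial X] in
theorem exp_dist_sub_one_le (x y : X) : Real.exp (S.B * dist x y) - 1 ≤ dist x y * Real.exp S.B := by
  have h := exp_mul_le_of_mem_Icc dist_nonneg (S.dist_le_one x y) S.B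
  rw [mul_comm] at h
  have := dist_nonneg (x := x) (y := y)
  linarith

theorem abs_apply_sub_le {u : Lip X ℝ} (hu : u ∈ S.realCone) (x₀ x y : X) :
    |u x - u y| ≤ Real.exp S.B ^ 2 * u x₀ * dist x y := by
  have key : ∀ x y, u x - u y ≤ Real.exp S.B ^ 2 * u x₀ * dist x y := fun x y => by
    have h1 := apply_le_exp_mul hu x y
    have h2 := S.exp_dist_sub_one_le x y
    have h3 := apply_le_exp_B_mul hu y x₀
    have h4 := apply_nonneg hu y
    calc u x - u y ≤ (Real.exp (S.B * dist x y) - 1) * u y := by linarith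
      _ ≤ dist x y * Real.exp S.B * (Real.exp S.B * u x₀) :=
          mul_le_mul h2 h3 h4 (by positivity)
      _ = _ := by ring
  refine abs_le.2 ⟨?_, key x y⟩
  have := key y x
  rw [dist_comm] at this
  linarith

/-- After rotation `w = p + i q`, and both `p x₀` and `q x₀` are at most `‖w x₀‖`. Functions in the
real cone are controlled by one value: `e^B` for the supremum and `e^{2 B}` for the Lipschitz
constant. -/
theorem norm_le_mul_norm_apply {w : Lip X ℂ} (hw : w ∈ complexCone S.realCone) (x₀ : X) :
    ‖w‖ ≤ 2 * (Real.exp S.B + Real.exp S.B ^ 2) * ‖w x₀‖ := by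
  obtain ⟨ζ, hζ, p, hp, q, hq, hwpq⟩ := exists_eq_mul_add_I_mul hw
  have hre : (p x₀ + Complex.I * q x₀ : ℂ).re = p x₀ := by simp
  have him : (p x₀ + Complex.I * q x₀ : ℂ).im = q x₀ := by simp
  have hn : ‖w x₀‖ = ‖(p x₀ + Complex.I * q x₀ : ℂ)‖ := by rw [hwpq, norm_mul, hζ, one_mul]
  have hp0 : p x₀ ≤ ‖w x₀‖ := by
    rw [hn, ← hre]
    exact (le_abs_self _).trans (by simpa using Complex.abs_re_le_norm (p x₀ + Complex.I * q x₀))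
  have hq0 : q x₀ ≤ ‖w x₀‖ := by
    rw [hn, ← him]
    exact (le_abs_self _).trans (by simpa using Complex.abs_im_le_norm (p x₀ + Complex.I * q x₀))
  have hadd : ∀ a b : ℝ, ‖(a + Complex.I * b : ℂ)‖ ≤ |a| + |b| := fun a b => by
    refine (norm_add_le _ _).trans ?_
    rw [norm_mul, Complex.norm_I, one_mul, Complex.norm_real, Complex.norm_real]
    rfl
  rw [Lip.norm_def]
  have h1 : w.supNorm ≤ 2 * Real.exp S.B * ‖w x₀‖ := Lip.supNorm_le (by positivity) fun x => by
    rw [hwpq x, norm_mul, hζ, one_mul]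
    refine (hadd _ _).trans ?_
    rw [abs_of_nonneg (apply_nonneg hp x), abs_of_nonneg (apply_nonneg hq x)]
    have a1 := apply_le_exp_B_mul hp x x₀
    have a2 := apply_le_exp_B_mul hq x x₀
    have a3 := Real.exp_pos S.B
    nlinarith
  have h2 : w.lipConst ≤ 2 * Real.exp S.B ^ 2 * ‖w x₀‖ := Lip.lipConst_le (by positivity)
    fun x y => by
    have h3 : w x - w y = ζ * (((p x - p y : ℝ) : ℂ) + Complex.I * ((q x - q y : ℝ) : ℂ)) := by
      rw [hwpq x, hwpq y]; push_cast; ring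
    rw [h3, norm_mul, hζ, one_mul]
    refine (hadd _ _).trans ((add_le_add (abs_apply_sub_le hp x₀ x y)
      (abs_apply_sub_le hq x₀ x y)).trans ?_)
    have a3 : 0 ≤ Real.exp S.B ^ 2 * dist x y := by positivity
    nlinarith
  linarith

end Cone

/-! ### Closedness, homogeneity and an interior point of the complexification -/

variable (S) in
theorem isClosed_insert_complexCone : IsClosed (insert 0 (complexCone S.realCone)) := by
  have h : insert 0 (complexCone S.realCone) =
      {w | ∀ x y x' y' : X, 0 ≤ (S.cgen x y w * (starRingEnd ℂ) (S.cgen x' y' w)).re} := by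
    ext w
    rw [Set.mem_insert_iff, mem_complexCone_iff]
    constructor
    · rintro (rfl | h)
      · intro x y x' y'; simp
      · exact h.2
    · intro h
      by_cases h0 : w = 0
      · exact Or.inl h0
      · exact Or.inr ⟨h0, h⟩
  rw [h]
  simp only [Set.ofPred_forall]
  refine isClosed_iInter fun x => isClosed_iInter fun y => isClosed_iInter fun x' =>
    isClosed_iInter fun y' => isClosed_le continuous_const ?_
  exact Complex.continuous_re.comp ((S.cgen x y).continuous.mul
    (Complex.continuous_conj.comp (S.cgen x' y').continuous))

theorem smul_mem_complexCone {w : Lip X ℂ} (hw : w ∈ complexCone S.realCone) {a : ℂ} (ha : a ≠ 0) :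
    a • w ∈ complexCone S.realCone := by
  rw [mem_complexCone_iff] at hw ⊢
  refine ⟨smul_ne_zero ha hw.1, fun x y x' y' => ?_⟩
  have h : S.cgen x y (a • w) * (starRingEnd ℂ) (S.cgen x' y' (a • w)) =
      ((‖a‖ ^ 2 : ℝ) : ℂ) * (S.cgen x y w * (starRingEnd ℂ) (S.cgen x' y' w)) := by
    rw [Complex.ofReal_pow, ← Complex.mul_conj', map_smul, map_smul, smul_eq_mul, smul_eq_mul,
      map_mul]
    ring
  rw [h, Complex.re_ofReal_mul]
  exact mul_nonneg (by positivity) (hw.2 x y x' y')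

/-- The generator at `(x, y)` takes the value `e^{B d} - 1 ≥ B d` at `1`. The radius makes its value
at `v` at most a quarter of this, and `2 η + η² < 1` for `η = 1 / 4`. -/
theorem one_add_mem_complexCone [Nonempty X] {v : Lip X ℂ} (hv : ‖v‖ ≤ S.B / (4 * (S.B + 1))) :
    1 + v ∈ complexCone S.realCone := by
  have hB := S.B_pos
  have hρ : S.B / (4 * (S.B + 1)) < 1 := by
    rw [div_lt_one (by positivity)]; linarith
  rw [mem_complexCone_iff]
  constructor
  · intro h0
    obtain ⟨x⟩ := ‹Nonempty X›
    have h1 : (1 : ℂ) + v x = 0 := congrArg (fun u : Lip X ℂ => u x) h0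
    have h2 : v x = -1 := by linear_combination h1
    have h3 := v.norm_apply_le_norm x
    rw [h2, norm_neg, norm_one] at h3
    linarith
  · intro x y x' y'
    have hτ : ∀ x y : X, S.B * dist x y ≤ Real.exp (S.B * dist x y) - 1 := fun x y => by
      linarith [Real.add_one_le_exp (S.B * dist x y)]
    have hτ0 : ∀ x y : X, 0 ≤ Real.exp (S.B * dist x y) - 1 := fun x y =>
      (mul_nonneg hB.le dist_nonneg).trans (hτ x y)
    have he : ∀ x y : X, ‖S.cgen x y v‖ ≤ 1 / 4 * (Real.exp (S.B * dist x y) - 1 + 0) := by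
      intro x y
      have h1 : S.cgen x y v =
          ((Real.exp (S.B * dist x y) - 1 : ℝ) : ℂ) * v y + (v y - v x) := by
        rw [cgen_apply]; push_cast; ring
      have h2 : ‖S.cgen x y v‖ ≤ (Real.exp (S.B * dist x y) - 1) * ‖v‖ + ‖v‖ * dist x y := by
        rw [h1]
        refine (norm_add_le _ _).trans (add_le_add ?_ ?_)
        · rw [norm_mul, Complex.norm_real, Real.norm_of_nonneg (hτ0 x y)]
          exact mul_le_mul_of_nonneg_left (v.norm_apply_le_norm y) (hτ0 x y)
        · rw [dist_comm]
          exact (v.norm_sub_le y x).trans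
            (mul_le_mul_of_nonneg_right v.lipConst_le_norm dist_nonneg)
      have h3 : dist x y ≤ (Real.exp (S.B * dist x y) - 1) / S.B := by
        rw [le_div_iff₀ hB, mul_comm]; exact hτ x y
      calc _ ≤ _ := h2
        _ ≤ (Real.exp (S.B * dist x y) - 1) * ‖v‖ +
            ‖v‖ * ((Real.exp (S.B * dist x y) - 1) / S.B) := by gcongr
        _ = ((Real.exp (S.B * dist x y) - 1) * (1 + 1 / S.B)) * ‖v‖ := by ring
        _ ≤ ((Real.exp (S.B * dist x y) - 1) * (1 + 1 / S.B)) * (S.B / (4 * (S.B + 1))) :=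
            mul_le_mul_of_nonneg_left hv (mul_nonneg (hτ0 x y) (by positivity))
        _ = _ := by field_simp; ring
    have hval : ∀ x y : X, S.cgen x y (1 + v) =
        ((Real.exp (S.B * dist x y) - 1 : ℝ) : ℂ) + Complex.I * ((0 : ℝ) : ℂ) + S.cgen x y v := by
      intro x y
      rw [map_add, cgen_apply]
      simp
    have h := re_mul_conj_ge (hτ0 x y) (hτ0 x' y') le_rfl le_rfl (by norm_num) (he x y) (he x' y')
    rw [hval, hval]
    refine le_trans ?_ h
    have := mul_nonneg (hτ0 x y) (hτ0 x' y')
    linarith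

/-! ### The unperturbed operator on the real cone -/

/-- The `j`-th term of the real transfer operator. -/
def realTerm (S : BranchSystem X J) (u : Lip X ℝ) (x : X) (j : J) : ℝ :=
  Real.exp (S.φ j x) * u (S.σ j x)

/-- The real transfer operator as a function on `X`. -/
def realOp (S : BranchSystem X J) (u : Lip X ℝ) (x : X) : ℝ := ∑' j, S.realTerm u x j

theorem summable_realTerm (S : BranchSystem X J) (u : Lip X ℝ) (x : X) :
    Summable (S.realTerm u x) :=
  Summable.of_norm_bounded ((S.summable_weights x).mul_right u.supNorm) fun j => by
    rw [realTerm, norm_mul, Real.norm_of_nonneg (Real.exp_pos _).le]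
    exact mul_le_mul_of_nonneg_left (u.norm_apply_le _) (Real.exp_pos _).le

/-- The `j`-th term of the perturbed operator on real functions. -/
def pertTerm (S : BranchSystem X J) (f : Lip X ℝ) (z : ℂ) (u : Lip X ℝ) (x : X) (j : J) : ℂ :=
  (S.realTerm u x j : ℂ) * Complex.exp (z * f (S.σ j x))

/-- The perturbed operator on real functions. -/
def pertOp (S : BranchSystem X J) (f : Lip X ℝ) (z : ℂ) (u : Lip X ℝ) (x : X) : ℂ :=
  ∑' j, S.pertTerm f z u x j

theorem norm_mul_apply_le (f : Lip X ℝ) (z : ℂ) (x : X) : ‖z * (f x : ℂ)‖ ≤ ‖z‖ * f.supNorm := by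
  rw [norm_mul, Complex.norm_real]
  exact mul_le_mul_of_nonneg_left (f.norm_apply_le _) (norm_nonneg _)

theorem norm_cexp_mul_apply_le (f : Lip X ℝ) (z : ℂ) (x : X) :
    ‖Complex.exp (z * (f x : ℂ))‖ ≤ Real.exp (‖z‖ * f.supNorm) := by
  rw [Complex.norm_exp]
  exact Real.exp_le_exp.2 ((Complex.re_le_norm _).trans (norm_mul_apply_le f z x))

theorem norm_pertTerm_le (f : Lip X ℝ) (z : ℂ) (u : Lip X ℝ) (x : X) (j : J) :
    ‖S.pertTerm f z u x j‖ ≤ |S.realTerm u x j| * Real.exp (‖z‖ * f.supNorm) := by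
  rw [pertTerm, norm_mul, Complex.norm_real]
  exact mul_le_mul_of_nonneg_left (norm_cexp_mul_apply_le f z _) (abs_nonneg _)

theorem summable_pertTerm (S : BranchSystem X J) (f : Lip X ℝ) (z : ℂ) (u : Lip X ℝ) (x : X) :
    Summable (S.pertTerm f z u x) :=
  Summable.of_norm_bounded ((S.summable_realTerm u x).abs.mul_right _)
    (norm_pertTerm_le f z u x)

theorem transferOp_apply_eq {f : Lip X ℝ} {z : ℂ} {w : Lip X ℂ} {ζ : ℂ} {p q : Lip X ℝ}
    (hw : ∀ x, w x = ζ * (p x + Complex.I * q x)) (x : X) :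
    S.transferOp f z w x = ζ * (S.pertOp f z p x + Complex.I * S.pertOp f z q x) := by
  rw [transferOp_apply, pertOp, pertOp, ← tsum_mul_left (a := Complex.I),
    ← (S.summable_pertTerm f z p x).tsum_add ((S.summable_pertTerm f z q x).mul_left _),
    ← tsum_mul_left]
  refine tsum_congr fun j => ?_
  rw [hw, Complex.exp_add, pertTerm, pertTerm, realTerm, realTerm]
  push_cast
  ring

section Cone

variable [Nontrivial X] {u : Lip X ℝ}

theorem realTerm_nonneg (hu : u ∈ S.realCone) (x : X) (j : J) : 0 ≤ S.realTerm u x j :=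
  mul_nonneg (Real.exp_pos _).le (apply_nonneg hu _)

theorem realOp_nonneg (hu : u ∈ S.realCone) (x : X) : 0 ≤ S.realOp u x :=
  tsum_nonneg (realTerm_nonneg hu x)

theorem realOp_pos [Nonempty J] (hu : u ∈ S.realCone) (h0 : u ≠ 0) (x : X) :
    0 < S.realOp u x := by
  obtain ⟨j⟩ := ‹Nonempty J›
  refine (S.summable_realTerm u x).tsum_pos (realTerm_nonneg hu x) j ?_
  refine mul_pos (Real.exp_pos _) ((apply_nonneg hu _).lt_of_ne fun h => h0 ?_)
  refine Lip.ext fun y => le_antisymm ?_ (apply_nonneg hu y)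
  have := apply_le_exp_B_mul hu y (S.σ j x)
  rwa [← h, mul_zero] at this

/-- The weight varies by `e^{G d}` and `u` along the branch by `e^{B γ⁻¹ d}`; the exponents add up
to `B' d`. -/
theorem realTerm_le (hu : u ∈ S.realCone) (x y : X) (j : J) :
    S.realTerm u x j ≤ Real.exp (S.B' * dist x y) * S.realTerm u y j := by
  have h1 : u (S.σ j x) ≤ Real.exp (S.B * (S.γ⁻¹ * dist x y)) * u (S.σ j y) := by
    refine (apply_le_exp_mul hu _ _).trans (mul_le_mul_of_nonneg_right ?_ (apply_nonneg hu _))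
    exact Real.exp_le_exp.2 (mul_le_mul_of_nonneg_left (S.contraction j x y) S.B_pos.le)
  have h2 : Real.exp (S.φ j x) ≤ Real.exp (S.G * dist x y) * Real.exp (S.φ j y) := by
    rw [← Real.exp_add]
    refine Real.exp_le_exp.2 ?_
    linarith [(abs_le.1 (S.distortion j x y)).2]
  rw [realTerm, realTerm]
  calc _ ≤ (Real.exp (S.G * dist x y) * Real.exp (S.φ j y)) *
        (Real.exp (S.B * (S.γ⁻¹ * dist x y)) * u (S.σ j y)) :=
        mul_le_mul h2 h1 (apply_nonneg hu _) (by positivity)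
    _ = _ := by
        rw [← G_add_B_div, add_mul, Real.exp_add, mul_assoc S.B]; ring

theorem realOp_le (hu : u ∈ S.realCone) (x y : X) :
    S.realOp u x ≤ Real.exp (S.B' * dist x y) * S.realOp u y := by
  rw [realOp, realOp, ← tsum_mul_left]
  exact (S.summable_realTerm u x).tsum_le_tsum (realTerm_le hu x y)
    ((S.summable_realTerm u y).mul_left _)

/-- The value of the generating functionals at the image under the real transfer operator. -/
def genOp (S : BranchSystem X J) (u : Lip X ℝ) (x y : X) : ℝ :=
  Real.exp (S.B * dist x y) * S.realOp u y - S.realOp u x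

theorem genOp_le (hu : u ∈ S.realCone) (x y : X) : S.genOp u x y ≤
    (Real.exp (S.B * dist x y) - Real.exp (-(S.B' * dist x y))) * S.realOp u y := by
  have h := mul_le_mul_of_nonneg_left (realOp_le hu y x) (Real.exp_pos (-(S.B' * dist x y))).le
  rw [← mul_assoc, ← Real.exp_add, dist_comm y x, neg_add_cancel, Real.exp_zero, one_mul] at h
  rw [genOp]
  linarith

theorem le_genOp (hu : u ∈ S.realCone) (x y : X) :
    (Real.exp (S.B * dist x y) - Real.exp (S.B' * dist x y)) * S.realOp u y ≤ S.genOp u x y := by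
  have h := realOp_le hu x y
  rw [genOp]
  linarith

omit [Nontrivial X] in
theorem dist_le_exp_sub_exp (S : BranchSystem X J) (x y : X) :
    S.γ⁻¹ * dist x y ≤ Real.exp (S.B * dist x y) - Real.exp (S.B' * dist x y) := by
  have h1 : S.B * dist x y = S.B' * dist x y + S.γ⁻¹ * dist x y := by rw [B_eq]; ring
  have h2 := Real.add_one_le_exp (S.γ⁻¹ * dist x y)
  have h3 : 0 ≤ S.γ⁻¹ * dist x y := mul_nonneg (inv_pos.2 S.γ_pos).le dist_nonneg
  have h4 : 1 ≤ Real.exp (S.B' * dist x y) :=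
    Real.one_le_exp (mul_nonneg S.B'_pos.le dist_nonneg)
  rw [h1, Real.exp_add]
  nlinarith

theorem genOp_nonneg (hu : u ∈ S.realCone) (x y : X) : 0 ≤ S.genOp u x y := by
  refine le_trans (mul_nonneg ?_ (realOp_nonneg hu y)) (le_genOp hu x y)
  exact (mul_nonneg (inv_pos.2 S.γ_pos).le dist_nonneg).trans (S.dist_le_exp_sub_exp x y)

theorem genOp_pos [Nonempty J] (hu : u ∈ S.realCone) (h0 : u ≠ 0) {x y : X} (hxy : x ≠ y) :
    0 < S.genOp u x y := by
  refine lt_of_lt_of_le (mul_pos ?_ (realOp_pos hu h0 y)) (le_genOp hu x y)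
  exact (mul_pos (inv_pos.2 S.γ_pos) (dist_pos.2 hxy)).trans_le (S.dist_le_exp_sub_exp x y)

/-- The real transfer operator maps the cone to a set of projective diameter at most `D`. -/
theorem genOp_mul_le {v : Lip X ℝ} (hu : u ∈ S.realCone) (hv : v ∈ S.realCone) (x y x' y' : X) :
    S.genOp u x y * S.genOp v x' y' ≤ Real.exp S.D * (S.genOp v x y * S.genOp u x' y') := by
  have hR := S.R_pos
  set t := Real.exp (S.B * dist x y) - Real.exp (S.B' * dist x y) with ht
  set t' := Real.exp (S.B * dist x' y') - Real.exp (S.B' * dist x' y') with ht'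
  have ht0 : 0 ≤ t := (mul_nonneg (inv_pos.2 S.γ_pos).le dist_nonneg).trans
    (S.dist_le_exp_sub_exp x y)
  have ht0' : 0 ≤ t' := (mul_nonneg (inv_pos.2 S.γ_pos).le dist_nonneg).trans
    (S.dist_le_exp_sub_exp x' y')
  -- Each generator value at `(x, y)` is comparable, up to the factor `R`, to `t` times the image at
  -- `y`; moving the base point costs `e^{B'}`. Doing this twice gives `R² e^{2 B'} = e^D`.
  have a1 : S.genOp u x y ≤ S.R * t * S.realOp u y := (genOp_le hu x y).trans
    (mul_le_mul_of_nonneg_right (S.exp_sub_exp_le (dist x y)) (realOp_nonneg hu y))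
  have a2 : S.genOp v x' y' ≤ S.R * t' * S.realOp v y' := (genOp_le hv x' y').trans
    (mul_le_mul_of_nonneg_right (S.exp_sub_exp_le (dist x' y')) (realOp_nonneg hv y'))
  have hexp : ∀ x y : X, Real.exp (S.B' * dist x y) ≤ Real.exp S.B' := fun x y =>
    Real.exp_le_exp.2 (mul_le_of_le_one_right S.B'_pos.le (S.dist_le_one x y))
  have a3 : S.realOp u y ≤ Real.exp S.B' * S.realOp u y' := (realOp_le hu y y').trans
    (mul_le_mul_of_nonneg_right (hexp _ _) (realOp_nonneg hu y'))
  have a4 : S.realOp v y' ≤ Real.exp S.B' * S.realOp v y := (realOp_le hv y' y).trans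
    (mul_le_mul_of_nonneg_right (hexp _ _) (realOp_nonneg hv y))
  have hu' := realOp_nonneg hu y'
  have hv' := realOp_nonneg hv y
  calc S.genOp u x y * S.genOp v x' y'
      ≤ (S.R * t * S.realOp u y) * (S.R * t' * S.realOp v y') :=
        mul_le_mul a1 a2 (genOp_nonneg hv x' y')
          (mul_nonneg (by positivity) (realOp_nonneg hu y))
    _ ≤ (S.R * t * (Real.exp S.B' * S.realOp u y')) *
          (S.R * t' * (Real.exp S.B' * S.realOp v y)) :=
        mul_le_mul (mul_le_mul_of_nonneg_left a3 (by positivity))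
          (mul_le_mul_of_nonneg_left a4 (by positivity))
          (mul_nonneg (by positivity) (realOp_nonneg hv y')) (by positivity)
    _ = Real.exp S.D * ((t * S.realOp v y) * (t' * S.realOp u y')) := by
        rw [exp_D, two_mul, Real.exp_add]; ring
    _ ≤ _ := by
        refine mul_le_mul_of_nonneg_left ?_ (Real.exp_pos _).le
        exact mul_le_mul (le_genOp hv x y) (le_genOp hu x' y') (by positivity)
          (genOp_nonneg hv x y)

/-! ### The perturbed operator -/

/-- The error splits into the generator value times `e^{z f} - 1`, and `a` times the difference of
the two exponential factors. The latter is of order `s = γ⁻¹ d`, and `s * a` is dominated by the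
generator value itself, because `B` exceeds `B'` by `γ⁻¹`. The relative error is the same for all
branches, so it survives summation. -/
theorem norm_pertTerm_gen_sub_le {f : Lip X ℝ} {z : ℂ} (hu : u ∈ S.realCone) (x y : X) (j : J) :
    ‖(Real.exp (S.B * dist x y) * S.pertTerm f z u y j - S.pertTerm f z u x j : ℂ) -
        ((Real.exp (S.B * dist x y) * S.realTerm u y j - S.realTerm u x j : ℝ) : ℂ)‖ ≤
      (Real.exp (‖z‖ * (f.supNorm + f.lipConst)) - 1) *
        (Real.exp (S.B * dist x y) * S.realTerm u y j - S.realTerm u x j) := by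
  set a := S.realTerm u x j with ha
  set b := S.realTerm u y j with hb
  set c := Real.exp (S.B * dist x y) with hc
  set s := S.γ⁻¹ * dist x y with hs
  have ha0 : 0 ≤ a := realTerm_nonneg hu x j
  have hs0 : 0 ≤ s := mul_nonneg (inv_pos.2 S.γ_pos).le dist_nonneg
  have hs1 : s ≤ 1 := (mul_le_of_le_one_left dist_nonneg
    (inv_le_one_of_one_le₀ S.one_lt_γ.le)).trans (S.dist_le_one x y)
  have hab : s * a ≤ c * b - a := by
    have h1 : a ≤ Real.exp (S.B' * dist x y) * b := realTerm_le hu x y j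
    have h2 : c = Real.exp s * Real.exp (S.B' * dist x y) := by
      rw [hc, B_eq, ← Real.exp_add]; congr 1; ring
    have h3 := mul_le_mul_of_nonneg_left h1 (Real.exp_pos s).le
    have h4 := mul_le_mul_of_nonneg_right (Real.add_one_le_exp s) ha0
    rw [h2]
    linarith
  have hab0 : 0 ≤ c * b - a := (mul_nonneg hs0 ha0).trans hab
  set vx := z * (f (S.σ j x) : ℂ) with hvx
  set vy := z * (f (S.σ j y) : ℂ) with hvy
  have hE1 : ‖Complex.exp vy - 1‖ ≤ Real.exp (‖z‖ * f.supNorm) - 1 :=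
    (norm_cexp_sub_one_le _).trans (sub_le_sub_right
      (Real.exp_le_exp.2 (norm_mul_apply_le f z _)) 1)
  have hE2 : ‖Complex.exp vy - Complex.exp vx‖ ≤
      Real.exp (‖z‖ * f.supNorm) * (s * (Real.exp (‖z‖ * f.lipConst) - 1)) := by
    have h1 : Complex.exp vy - Complex.exp vx = Complex.exp vx * (Complex.exp (vy - vx) - 1) := by
      rw [mul_sub, ← Complex.exp_add]; ring_nf
    have h2 : ‖vy - vx‖ ≤ s * (‖z‖ * f.lipConst) := by
      have h3 : vy - vx = z * ((f (S.σ j y) - f (S.σ j x) : ℝ) : ℂ) := by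
        rw [hvx, hvy]; push_cast; ring
      rw [h3, norm_mul, Complex.norm_real]
      have h4 := (f.norm_sub_le (S.σ j y) (S.σ j x)).trans
        (mul_le_mul_of_nonneg_left (S.contraction j y x) f.lipConst_nonneg)
      rw [dist_comm y x] at h4
      calc _ ≤ ‖z‖ * (f.lipConst * s) := mul_le_mul_of_nonneg_left h4 (norm_nonneg _)
        _ = _ := by ring
    have h5 : ‖Complex.exp (vy - vx) - 1‖ ≤ s * (Real.exp (‖z‖ * f.lipConst) - 1) := by
      have h6 := (norm_cexp_sub_one_le _).trans (sub_le_sub_right (Real.exp_le_exp.2 h2) 1)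
      have h7 := exp_mul_le_of_mem_Icc hs0 hs1 (‖z‖ * f.lipConst)
      linarith
    rw [h1, norm_mul]
    exact mul_le_mul (norm_cexp_mul_apply_le f z _) h5 (norm_nonneg _) (Real.exp_pos _).le
  have hsplit : (c * S.pertTerm f z u y j - S.pertTerm f z u x j : ℂ) - ((c * b - a : ℝ) : ℂ) =
      ((c * b - a : ℝ) : ℂ) * (Complex.exp vy - 1) + (a : ℂ) * (Complex.exp vy - Complex.exp vx) := by
    rw [pertTerm, pertTerm, ← ha, ← hb, ← hvx, ← hvy]
    push_cast
    ring
  have hL : 0 ≤ Real.exp (‖z‖ * f.lipConst) - 1 :=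
    sub_nonneg.2 (Real.one_le_exp (mul_nonneg (norm_nonneg _) f.lipConst_nonneg))
  rw [hsplit]
  refine (norm_add_le _ _).trans ?_
  rw [norm_mul, norm_mul, Complex.norm_real, Complex.norm_real, Real.norm_of_nonneg hab0,
    Real.norm_of_nonneg ha0]
  calc _ ≤ (c * b - a) * (Real.exp (‖z‖ * f.supNorm) - 1) +
        a * (Real.exp (‖z‖ * f.supNorm) * (s * (Real.exp (‖z‖ * f.lipConst) - 1))) :=
        add_le_add (mul_le_mul_of_nonneg_left hE1 hab0) (mul_le_mul_of_nonneg_left hE2 ha0)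
    _ = (c * b - a) * (Real.exp (‖z‖ * f.supNorm) - 1) +
        (s * a) * (Real.exp (‖z‖ * f.supNorm) * (Real.exp (‖z‖ * f.lipConst) - 1)) := by ring
    _ ≤ (c * b - a) * (Real.exp (‖z‖ * f.supNorm) - 1) +
        (c * b - a) * (Real.exp (‖z‖ * f.supNorm) * (Real.exp (‖z‖ * f.lipConst) - 1)) :=
        add_le_add le_rfl (mul_le_mul_of_nonneg_right hab (mul_nonneg (Real.exp_pos _).le hL))
    _ = _ := by rw [mul_add, Real.exp_add]; ring

theorem norm_pertOp_gen_sub_le {f : Lip X ℝ} {z : ℂ} (hu : u ∈ S.realCone) (x y : X) :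
    ‖(Real.exp (S.B * dist x y) * S.pertOp f z u y - S.pertOp f z u x : ℂ) - (S.genOp u x y : ℂ)‖ ≤
      (Real.exp (‖z‖ * (f.supNorm + f.lipConst)) - 1) * S.genOp u x y := by
  have h1 := ((S.summable_realTerm u y).hasSum.mul_left (Real.exp (S.B * dist x y))).sub
    (S.summable_realTerm u x).hasSum
  have h2 := ((S.summable_pertTerm f z u y).hasSum.mul_left (Real.exp (S.B * dist x y) : ℂ)).sub
    (S.summable_pertTerm f z u x).hasSum
  have h3 := h2.sub (Complex.hasSum_ofReal.2 h1)
  have h4 := h1.mul_left (Real.exp (‖z‖ * (f.supNorm + f.lipConst)) - 1)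
  have h5 := tsum_of_norm_bounded h4 (fun j => norm_pertTerm_gen_sub_le (f := f) (z := z) hu x y j)
  rw [h3.tsum_eq] at h5
  exact h5

theorem norm_pertOp_le {f : Lip X ℝ} {z : ℂ} (hu : u ∈ S.realCone) (x : X) :
    ‖S.pertOp f z u x‖ ≤ Real.exp (‖z‖ * f.supNorm) * S.realOp u x := by
  rw [mul_comm]
  refine tsum_of_norm_bounded ((S.summable_realTerm u x).hasSum.mul_right _) fun j => ?_
  have := norm_pertTerm_le (S := S) f z u x j
  rwa [abs_of_nonneg (realTerm_nonneg hu x j)] at this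

/-- The generating functionals at the constant `1` are dominated by their values on the image of the
real cone. -/
theorem exp_sub_one_mul_realOp_le (hu : u ∈ S.realCone) (x₀ x y : X) :
    (Real.exp (S.B * dist x y) - 1) * S.realOp u x₀ ≤
      S.γ * Real.exp S.B * Real.exp S.B' * S.genOp u x y := by
  have hγ := S.γ_pos
  have h1 := S.exp_dist_sub_one_le x y
  have h2 : S.realOp u x₀ ≤ Real.exp S.B' * S.realOp u y := (realOp_le hu x₀ y).trans
    (mul_le_mul_of_nonneg_right (Real.exp_le_exp.2
      (mul_le_of_le_one_right S.B'_pos.le (S.dist_le_one x₀ y))) (realOp_nonneg hu y))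
  have h3 := (mul_le_mul_of_nonneg_right (S.dist_le_exp_sub_exp x y) (realOp_nonneg hu y)).trans
    (le_genOp hu x y)
  calc _ ≤ (dist x y * Real.exp S.B) * (Real.exp S.B' * S.realOp u y) :=
        mul_le_mul h1 h2 (realOp_nonneg hu x₀) (by positivity)
    _ = S.γ * Real.exp S.B * Real.exp S.B' * (S.γ⁻¹ * dist x y * S.realOp u y) := by
        field_simp
    _ ≤ _ := mul_le_mul_of_nonneg_left h3 (by positivity)

variable (S) in
/-- The size of the admissible perturbations, `1 / (3 (1 + cosh (D / 2)))`. -/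
def pertSize : ℝ := 1 / (3 * (1 + Real.cosh (S.D / 2)))

omit [Nontrivial X] in
theorem pertSize_pos (S : BranchSystem X J) : 0 < S.pertSize := by
  have := Real.cosh_pos (S.D / 2)
  rw [pertSize]; positivity

omit [Nontrivial X] in
theorem pertSize_le (S : BranchSystem X J) : S.pertSize ≤ 1 / 6 := by
  have := Real.one_le_cosh (S.D / 2)
  rw [pertSize]
  exact one_div_le_one_div_of_le (by norm_num) (by linarith)

omit [Nontrivial X] in
theorem pertSize_mul (S : BranchSystem X J) :
    S.pertSize * (1 + Real.cosh (S.D / 2)) = 1 / 3 := by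
  have := Real.cosh_pos (S.D / 2)
  rw [pertSize]; field_simp

/-- The transfer operator maps the complex cone uniformly into its interior. -/
theorem transferOp_sub_mem [Nonempty J] {f : Lip X ℝ} {z : ℂ}
    (hz : ‖z‖ * (f.supNorm + f.lipConst) ≤ S.pertSize) (x₀ : X) {w : Lip X ℂ}
    (hw : w ∈ complexCone S.realCone) {s : ℂ}
    (hs : ‖s‖ ≤ S.pertSize / (24 * (S.γ * Real.exp S.B * Real.exp S.B')) *
      ‖S.transferOp f z w x₀‖) :
    S.transferOp f z w - s • (1 : Lip X ℂ) ∈ complexCone S.realCone := by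
  obtain ⟨ζ, hζ, p, hp, q, hq, hwpq⟩ := exists_eq_mul_add_I_mul hw
  have hγ := S.γ_pos
  have hδ0 := S.pertSize_pos
  have hδ6 := S.pertSize_le
  set δ := S.pertSize with hδ
  set ch := Real.cosh (S.D / 2) with hch
  have hch0 : 0 < ch := Real.cosh_pos _
  have hδch : δ * (1 + ch) = 1 / 3 := S.pertSize_mul
  set M := S.γ * Real.exp S.B * Real.exp S.B' with hM
  have hM0 : 0 < M := by positivity
  have hζ0 : ζ ≠ 0 := by
    rintro rfl
    simp at hζ
  have hτ0 : ∀ x y : X, 0 ≤ Real.exp (S.B * dist x y) - 1 := fun x y =>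
    sub_nonneg.2 (Real.one_le_exp (mul_nonneg S.B_pos.le dist_nonneg))
  -- `e^δ - 1 ≤ δ + δ²` and `δ ≤ 1 / 6`.
  have hε : Real.exp (‖z‖ * (f.supNorm + f.lipConst)) - 1 ≤ 7 / 6 * δ := by
    have h1 := Real.exp_le_exp.2 hz
    have h2 := (abs_le.1 (Real.abs_exp_sub_one_sub_id_le
      (x := δ) (by rw [abs_of_pos hδ0]; linarith))).2
    nlinarith
  have hexp2 : Real.exp (‖z‖ * f.supNorm) ≤ 2 := by
    have h1 : ‖z‖ * f.supNorm ≤ ‖z‖ * (f.supNorm + f.lipConst) :=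
      mul_le_mul_of_nonneg_left (le_add_of_nonneg_right f.lipConst_nonneg) (norm_nonneg _)
    have h2 := Real.exp_le_exp.2 h1
    linarith
  have hval : ‖S.transferOp f z w x₀‖ ≤ 2 * (S.realOp p x₀ + S.realOp q x₀) := by
    rw [transferOp_apply_eq hwpq, norm_mul, hζ, one_mul]
    refine (norm_add_le _ _).trans ?_
    rw [norm_mul, Complex.norm_I, one_mul]
    have h1 := norm_pertOp_le (f := f) (z := z) hp x₀
    have h2 := norm_pertOp_le (f := f) (z := z) hq x₀
    have h3 := mul_le_mul_of_nonneg_right hexp2 (realOp_nonneg hp x₀)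
    have h4 := mul_le_mul_of_nonneg_right hexp2 (realOp_nonneg hq x₀)
    linarith
  set E : X → X → ℂ := fun x y =>
    S.cgen x y ((starRingEnd ℂ) ζ • (S.transferOp f z w - s • (1 : Lip X ℂ))) -
      (S.genOp p x y + Complex.I * S.genOp q x y) with hE
  have hcζ : (starRingEnd ℂ) ζ * ζ = 1 := by rw [Complex.conj_mul', hζ]; simp
  have hEeq : ∀ x y, E x y =
      ((Real.exp (S.B * dist x y) * S.pertOp f z p y - S.pertOp f z p x) - S.genOp p x y) +
      Complex.I * ((Real.exp (S.B * dist x y) * S.pertOp f z q y - S.pertOp f z q x) -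
        S.genOp q x y) -
      (starRingEnd ℂ) ζ * s * ((Real.exp (S.B * dist x y) - 1 : ℝ) : ℂ) := by
    intro x y
    simp only [hE]
    rw [map_smul, map_sub, map_smul, cgen_apply, cgen_apply, transferOp_apply_eq hwpq,
      transferOp_apply_eq hwpq, Lip.one_apply, Lip.one_apply]
    simp only [smul_eq_mul]
    push_cast
    linear_combination (Complex.exp (S.B * dist x y) *
      (S.pertOp f z p y + Complex.I * S.pertOp f z q y) -
        (S.pertOp f z p x + Complex.I * S.pertOp f z q x)) * hcζ
  -- The error budget is `7/6 δ` for the perturbation and `1/12 δ` for the shift by `s`, together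
  -- `5/4 δ`. The constant `24 M` in the bound for `s` is chosen for the second part.
  have hEle : ∀ x y, ‖E x y‖ ≤ 5 / 4 * δ * (S.genOp p x y + S.genOp q x y) := by
    intro x y
    have hg := genOp_nonneg hp x y
    have hg' := genOp_nonneg hq x y
    have h1 := (norm_pertOp_gen_sub_le (f := f) (z := z) hp x y).trans
      (mul_le_mul_of_nonneg_right hε hg)
    have h2 := (norm_pertOp_gen_sub_le (f := f) (z := z) hq x y).trans
      (mul_le_mul_of_nonneg_right hε hg')
    have h3 : ‖(starRingEnd ℂ) ζ * s * ((Real.exp (S.B * dist x y) - 1 : ℝ) : ℂ)‖ ≤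
        δ / 12 * (S.genOp p x y + S.genOp q x y) := by
      rw [norm_mul, norm_mul, RCLike.norm_conj, hζ, one_mul, Complex.norm_real,
        Real.norm_of_nonneg (hτ0 x y)]
      have h4 := exp_sub_one_mul_realOp_le hp x₀ x y
      have h5 := exp_sub_one_mul_realOp_le hq x₀ x y
      calc _ ≤ (δ / (24 * M) * (2 * (S.realOp p x₀ + S.realOp q x₀))) *
            (Real.exp (S.B * dist x y) - 1) :=
            mul_le_mul_of_nonneg_right
              (hs.trans (mul_le_mul_of_nonneg_left hval (by positivity))) (hτ0 x y)
        _ = δ / (12 * M) * ((Real.exp (S.B * dist x y) - 1) * S.realOp p x₀ +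
            (Real.exp (S.B * dist x y) - 1) * S.realOp q x₀) := by
            field_simp; ring
        _ ≤ δ / (12 * M) * (M * S.genOp p x y + M * S.genOp q x y) := by gcongr
        _ = _ := by field_simp
    rw [hEeq]
    refine (norm_sub_le _ _).trans ((add_le_add (norm_add_le _ _) le_rfl).trans ?_)
    rw [norm_mul, Complex.norm_I, one_mul]
    linarith
  have hsum : ∀ x y, S.cgen x y ((starRingEnd ℂ) ζ • (S.transferOp f z w - s • (1 : Lip X ℂ))) =
      S.genOp p x y + Complex.I * S.genOp q x y + E x y := fun x y => by
    simp only [hE]; ring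
  have hmain : ∀ x y x' y' : X, 1 / 20 * (S.genOp p x y * S.genOp p x' y' +
      S.genOp q x y * S.genOp q x' y') ≤
      (S.cgen x y ((starRingEnd ℂ) ζ • (S.transferOp f z w - s • (1 : Lip X ℂ))) *
        (starRingEnd ℂ) (S.cgen x' y'
          ((starRingEnd ℂ) ζ • (S.transferOp f z w - s • (1 : Lip X ℂ))))).re := by
    intro x y x' y'
    have hp₁ := genOp_nonneg hp x y
    have hp₂ := genOp_nonneg hp x' y'
    have hq₁ := genOp_nonneg hq x y
    have hq₂ := genOp_nonneg hq x' y'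
    rw [hsum, hsum]
    refine le_trans ?_ (re_mul_conj_ge hp₁ hp₂ hq₁ hq₂ (by positivity) (hEle x y) (hEle x' y'))
    have hcross := cross_le_cosh_mul hp₁ hp₂ hq₁ hq₂ (genOp_mul_le hp hq x y x' y')
      (genOp_mul_le hq hp x y x' y')
    set T := S.genOp p x y * S.genOp p x' y' + S.genOp q x y * S.genOp q x' y' with hT
    have hT0 : 0 ≤ T := by positivity
    have hprod : (S.genOp p x y + S.genOp q x y) * (S.genOp p x' y' + S.genOp q x' y') ≤
        (1 + ch) * T := by
      rw [hT]
      linarith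
    -- Since `δ (1 + cosh (D / 2)) = 1 / 3`, the loss is at most `57/20 · 1/3 = 19/20` of the main
    -- term `T`, and `1/20` of it remains.
    have hη : 2 * (5 / 4 * δ) + (5 / 4 * δ) ^ 2 ≤ 57 / 20 * δ := by nlinarith
    have h1 := mul_le_mul hη hprod (mul_nonneg (add_nonneg hp₁ hq₁) (add_nonneg hp₂ hq₂))
      (by positivity)
    have h2 : 57 / 20 * δ * ((1 + ch) * T) = 19 / 20 * T := by
      calc _ = 57 / 20 * (δ * (1 + ch)) * T := by ring
        _ = _ := by rw [hδch]; ring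
    linarith
  have hmem : (starRingEnd ℂ) ζ • (S.transferOp f z w - s • (1 : Lip X ℂ)) ∈
      complexCone S.realCone := by
    rw [mem_complexCone_iff]
    refine ⟨fun h0 => ?_, fun x y x' y' => (hmain x y x' y').trans' ?_⟩
    -- A pair of distinct points is needed: the generators vanish on the diagonal and are positive
    -- on the nonzero one of the images of `p`, `q` off it.
    · obtain ⟨x, y, hxy⟩ := exists_pair_ne X
      have h1 := hmain x y x y
      rw [h0, map_zero, zero_mul, Complex.zero_re] at h1
      have hpq : p ≠ 0 ∨ q ≠ 0 := by
        by_contra! hpq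
        refine hw.1 (Lip.ext fun x => ?_)
        rw [hwpq, hpq.1, hpq.2]
        simp
      rcases hpq with h | h
      · have h2 := genOp_pos hp h hxy
        nlinarith [sq_nonneg (S.genOp q x y), mul_pos h2 h2]
      · have h2 := genOp_pos hq h hxy
        nlinarith [sq_nonneg (S.genOp p x y), mul_pos h2 h2]
    · have hp₁ := genOp_nonneg hp x y
      have hp₂ := genOp_nonneg hp x' y'
      have hq₁ := genOp_nonneg hq x y
      have hq₂ := genOp_nonneg hq x' y'
      positivity
  have h := smul_mem_complexCone hmem hζ0
  rwa [smul_smul, mul_comm, hcζ, one_smul] at h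

/-- The transfer operators with small parameter are uniformly strict contractions of the cone. -/
theorem isConeContraction_transferOp [Nonempty J] {f : Lip X ℝ} {z : ℂ}
    (hz : ‖z‖ * (f.supNorm + f.lipConst) ≤ S.pertSize) (x₀ : X) :
    IsConeContraction (complexCone S.realCone) 1 (Lip.eval x₀) (S.B / (4 * (S.B + 1)))
      (2 * (Real.exp S.B + Real.exp S.B ^ 2))
      (S.pertSize / (24 * (S.γ * Real.exp S.B * Real.exp S.B'))) (S.transferOp f z) where
  ρ_pos := by have := S.B_pos; positivity
  K_pos := by positivity
  t_pos := by have := S.pertSize_pos; have := S.γ_pos; positivity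
  zero_notMem h := h.1 rfl
  smul_mem _ hw _ ha := smul_mem_complexCone hw ha
  isClosed := S.isClosed_insert_complexCone
  interior _ hv := one_add_mem_complexCone hv
  norm_le _ hw := norm_le_mul_norm_apply hw x₀
  map_sub_mem _ hw _ hs := transferOp_sub_mem hz x₀ hw hs

end Cone

end BranchSystem

end ExpandingMaps

end
theorem mainTheorem4 {X J : Type*} [MetricSpace X] [CompactSpace X] [Nontrivial X]
    [Countable J] [Nonempty J] (S : ExpandingMaps.BranchSystem X J)
    (f : ExpandingMaps.Lip X ℝ) (δ₀ : ℝ)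
    (hδ₀ : δ₀ * (f.supNorm + f.lipConst) = 1 / (3 * (1 + Real.cosh (S.D / 2)))) :
    ∃ (h : ℂ → ExpandingMaps.Lip X ℂ) (ν : ℂ → (ExpandingMaps.Lip X ℂ →L[ℂ] ℂ)) (lam : ℂ → ℂ),
      (∀ z : ℂ, ‖z‖ ≤ δ₀ →
        h z ∈ ExpandingMaps.complexCone S.realCone ∧
        ν z ∈ ExpandingMaps.dualComplement (ExpandingMaps.complexCone S.realCone) ∧
        lam z ≠ 0 ∧
        S.transferOp f z (h z) = lam z • h z ∧
        (ν z).comp (S.transferOp f z) = lam z • ν z ∧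
        ν z (h z) = 1 ∧
        ν z 1 = 1 ∧
        ExpandingMaps.IsSimpleEigenvalue (S.transferOp f z) (lam z) ∧
        ∃ r : ℝ, 0 ≤ r ∧ r < ‖lam z‖ ∧
          spectrum ℂ (S.transferOp f z) \ {lam z} ⊆ Metric.closedBall 0 r) ∧
      DifferentiableOn ℂ h (Metric.ball 0 δ₀) ∧
      DifferentiableOn ℂ ν (Metric.ball 0 δ₀) ∧
      DifferentiableOn ℂ lam (Metric.ball 0 δ₀) := by
  -- The base point only fixes the normalizing functional `m`, evaluation at `x₀`; the normalization
  -- `⟨ν, 1⟩ = 1` comes from `e = 1`.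
  obtain ⟨x₀⟩ : Nonempty X := inferInstance
  refine ExpandingMaps.exists_holomorphic_eigendata (S.differentiable_transferOp f) fun z hz =>
    S.isConeContraction_transferOp ?_ x₀
  refine (mul_le_mul_of_nonneg_right hz
    (add_nonneg f.supNorm_nonneg f.lipConst_nonneg)).trans (le_of_eq ?_)
  rw [hδ₀, ExpandingMaps.BranchSystem.pertSize]
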